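/- Let $\mathbb K=\mathbb R$ or $\mathbb C$, let $N\ge 2$, and let $I,J\subseteq\mathbb K$ be open connected sets (open intervals if $\mathbb K=\mathbb R$), with variables $x\in I$, $t\in J$. "Smooth" means $C^\infty$ over $\mathbb K$. For $a\in\mathbb K$ and $b\in\mathbb K\cup\{\infty\}$, a *solution of the Ferapontov–Shabat–Yamilov lattice with boundary condition $v_0=a$, $v_N=b$* is a tuple of smooth functions $v_1,\dots,v_{N-1}:I\times J\to\mathbb K$ such that $v_{n-1}\ne v_n$ everywhere for $1\le n\le N$, and $$\partial_t\partial_x v_n=\partial_t v_n\,\partial_x v_n\left(\frac1{v_n-v_{n-1}}-\frac1{v_{n+1}-v_n}\right),\qquad 1\le n\le N-1,$$ where $\frac1{v_N-v_{N-1}}$ is read as $0$ if $v_N=\infty$. It is *nondegenerate* if $\partial_t v_n$ and $\partial_x v_n$ vanish nowhere for $1\le n\le N-2$. For smooth functions $X_1,\dots,X_{N-1}$ on $I$ and $T_1,\dots,T_{N-1}$ on $J$ put $$A_n=\det\Big(\sum_{s=1}^{N-1}X_s^{(i)}T_s^{(j)}\Big)_{i,j=1}^{n-1},\qquad B_n=\det\Big(\sum_{s=1}^{N-1}X_s^{(k-1)}T_s^{(l-1)}\Big)_{k,l=1}^{n}\qquad(A_1=1).$$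 1. (Boundary condition $v_0=0$, $v_N=\infty$.) If $B_1,\dots,B_{N-1}$ vanish nowhere and the functions $v_n=A_n/B_n$ satisfy $v_{n-1}\neq v_n$ everywhere for $1\le n\le N-1$ (with $v_0=0$), then $v_1,\dots,v_{N-1}$ is a nondegenerate solution with $v_0=0$, $v_N=\infty$; moreover $B_N\equiv 0$, and $A_N\ne0$ at every point where $\partial_tv_{N-1}\,\partial_xv_{N-1}\ne0$. Conversely, every nondegenerate solution with $v_0=0$, $v_N=\infty$ is of the form $v_n=A_n/B_n$ on $I\times J$, with $B_1,\dots,B_{N-1}$ nowhere zero, for some smooth $X_s$, $T_s$ ($2N-2$ functions). 2. (Boundary condition $\varphi_0=a$, $\varphi_N=b$ with $a,b\in\mathbb K$, $a\neq b$.) Put $$\varphi_n=\frac{(a-b)A_n}{(a-b)B_n-A_n}+a ,$$ which is the image of $v_n=A_n/B_n$ under the Möbius map $v\mapsto\frac{(a-b)v}{a-b-v}+a$ wherever $B_n\neq0$. If $(a-b)B_n-A_n$ vanishes nowhere for $1\le n\le N-1$ and $\varphi_{n-1}\ne\varphi_n$ everywhere for $1\le n\le N$ (with $\varphi_0=a$,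 $\varphi_N=b$), then $\varphi_1,\dots,\varphi_{N-1}$ is a nondegenerate solution with $\varphi_0=a$, $\varphi_N=b$. Conversely, every nondegenerate solution with $\varphi_0=a$, $\varphi_N=b$ is of this form, with $(a-b)B_n-A_n$ nowhere zero for $1\le n\le N-1$, for some smooth $X_s$, $T_s$. -/

import Mathlib

open scoped ContDiff

namespace FSY

variable {𝕜 : Type*} [RCLike 𝕜]

/-- The partial derivative in the first variable `x`. -/
noncomputable def dx (f : 𝕜 → 𝕜 → 𝕜) (x t : 𝕜) : 𝕜 := deriv (fun y => f y t) x

/-- The partial derivative in the second variable `t`. -/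
noncomputable def dt (f : 𝕜 → 𝕜 → 𝕜) (x t : 𝕜) : 𝕜 := deriv (fun s => f x s) t

/-- The reciprocal difference `1 / (p - q)` on the projective line, with `1 / (p - q) = 0` if one of
`p`, `q` is the point at infinity. It is only used for `p ≠ q`. -/
noncomputable def recipDiff : OnePoint 𝕜 → OnePoint 𝕜 → 𝕜
  | some p, some q => 1 / (p - q)
  | _, _ => 0

/-- The value at site `n` of the finite lattice `v_0 = a, v_1, …, v_{N-1}, v_N = b`; the boundary
value `b` may be the point at infinity. -/
noncomputable def site (N : ℕ) (a : 𝕜) (b : OnePoint 𝕜) (v : ℕ → 𝕜 → 𝕜 → 𝕜) (n : ℕ) (x t : 𝕜) :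
    OnePoint 𝕜 :=
  if n = 0 then (a : OnePoint 𝕜) else if n < N then (v n x t : OnePoint 𝕜) else b

/-- Neighbouring lattice values never coincide on `I × J`, that is, all the differences in the
denominators of the lattice equations are nonzero. -/
def NeighboursDistinct (N : ℕ) (a : 𝕜) (b : OnePoint 𝕜) (I J : Set 𝕜) (v : ℕ → 𝕜 → 𝕜 → 𝕜) : Prop :=
  ∀ n, n < N → ∀ x ∈ I, ∀ t ∈ J, site N a b v n x t ≠ site N a b v (n + 1) x t

/-- `v_1, …, v_{N-1}` is a smooth solution on `I × J` of the Ferapontov-Shabat-Yamilov lattice with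
boundary condition `v_0 = a`, `v_N = b`. -/
structure IsSolution (N : ℕ) (a : 𝕜) (b : OnePoint 𝕜) (I J : Set 𝕜) (v : ℕ → 𝕜 → 𝕜 → 𝕜) : Prop where
  smooth : ∀ n, 1 ≤ n → n < N → ContDiffOn 𝕜 ∞ (fun p : 𝕜 × 𝕜 => v n p.1 p.2) (I ×ˢ J)
  distinct : NeighboursDistinct N a b I J v
  equation : ∀ n, 1 ≤ n → n < N → ∀ x ∈ I, ∀ t ∈ J,
    dx (dt (v n)) x t = dt (v n) x t * dx (v n) x t *
      (recipDiff (site N a b v n x t) (site N a b v (n - 1) x t)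
        - recipDiff (site N a b v (n + 1) x t) (site N a b v n x t))

/-- Nondegeneracy: both first derivatives of `v_1, …, v_{N-2}` are nowhere zero on `I × J`. -/
def Nondegenerate (N : ℕ) (I J : Set 𝕜) (v : ℕ → 𝕜 → 𝕜 → 𝕜) : Prop :=
  ∀ n, 1 ≤ n → n + 1 < N → ∀ x ∈ I, ∀ t ∈ J, dt (v n) x t ≠ 0 ∧ dx (v n) x t ≠ 0

/-- `det (a_ij)`, `1 ≤ i, j ≤ n - 1`, where `a_ij = ∑ s, X_s^(i) T_s^(j)` (for `n ≥ 1`; the empty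
determinant is `1`). -/
noncomputable def detA {m : ℕ} (X T : Fin m → 𝕜 → 𝕜) (n : ℕ) (x t : 𝕜) : 𝕜 :=
  Matrix.det (Matrix.of fun i j : Fin (n - 1) =>
    ∑ s, iteratedDeriv ((i : ℕ) + 1) (X s) x * iteratedDeriv ((j : ℕ) + 1) (T s) t)

/-- `det (b_kl)`, `1 ≤ k, l ≤ n`, where `b_kl = ∑ s, X_s^(k-1) T_s^(l-1)`. -/
noncomputable def detB {m : ℕ} (X T : Fin m → 𝕜 → 𝕜) (n : ℕ) (x t : 𝕜) : 𝕜 :=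
  Matrix.det (Matrix.of fun k l : Fin n =>
    ∑ s, iteratedDeriv (k : ℕ) (X s) x * iteratedDeriv (l : ℕ) (T s) t)

/-- `v_n = det (a_ij) / det (b_kl)`. -/
noncomputable def vSol {m : ℕ} (X T : Fin m → 𝕜 → 𝕜) (n : ℕ) (x t : 𝕜) : 𝕜 :=
  detA X T n x t / detB X T n x t

/-- The Möbius map with `0 ↦ a`, `∞ ↦ b`. -/
noncomputable def mobius (a b v : 𝕜) : 𝕜 := (a - b) * v / (a - b - v) + a

/-- The denominator of the Möbius map `mobius a b` at the point `[det (a_ij) : det (b_kl)]` of the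
projective line. It is nonzero exactly if this is a well-defined point with finite image. -/
noncomputable def phiDen {m : ℕ} (a b : 𝕜) (X T : Fin m → 𝕜 → 𝕜) (n : ℕ) (x t : 𝕜) : 𝕜 :=
  (a - b) * detB X T n x t - detA X T n x t

/-- The image of `v_n = [det (a_ij) : det (b_kl)]` under `mobius a b`, in homogeneous form, so that it
also makes sense where `det (b_kl) = 0`, i.e. `v_n = ∞`. -/
noncomputable def phiSol {m : ℕ} (a b : 𝕜) (X T : Fin m → 𝕜 → 𝕜) (n : ℕ) (x t : 𝕜) : 𝕜 :=
  (a - b) * detA X T n x t / phiDen a b X T n x t + a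

end FSY

/-!
For a solution with `v₀ = c` let `f = 1 / (v₁ - c)` and let `a` be the array of the mixed
derivatives `a i j = ∂ₓⁱ ∂ₜʲ f`. Write `Bₙ` for its leading `n × n` minors and `Aₙ` for the same
minors with row and column `0` removed. Bordering the leading block by one row and one column gives
a column relation and a row relation, with first entries `pₙ` and `qₙ`, and the Schur complement
`sₙ = Bₙ₊₁ / Bₙ`. The quotients `vₙ = c + Aₙ / Bₙ` satisfy
`vₙ₊₁ - vₙ = pₙ qₙ / sₙ`, `∂ₓ vₙ₊₁ = pₙ qₙ₊₁ / sₙ` and `∂ₜ vₙ₊₁ = qₙ pₙ₊₁ / sₙ`.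

Given the values `v₀, …, vₙ`, the lattice equation at site `n` therefore says
`sₙ = pₙ qₙ / (vₙ₊₁ - vₙ)`, so by induction every nondegenerate solution consists of these
quotients. At the last site the equation says `B_N = 0` when `v_N = ∞`; when `v_N = d` is finite it
says the same of the array whose corner entry `a 0 0` is shifted by `1 / (c - d)`. As `B_{N-1}` does
not vanish, `B_N = 0` makes `f` (shifted likewise) a solution of a linear ordinary differential
equation of order `N - 1` in each variable, that is, a separable kernel `∑ X_s T_s` with `N - 1`
terms.
-/

namespace FSY

open Matrix Topology

section Bordering

variable {R : Type*} [CommRing R] {n : ℕ} {A : Matrix (Fin (n + 1)) (Fin (n + 1)) R}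
  {u : Fin (n + 1) → R} {s : R}

lemma adjugate_last_last (A : Matrix (Fin (n + 1)) (Fin (n + 1)) R) :
    A.adjugate (Fin.last n) (Fin.last n) = (A.submatrix Fin.castSucc Fin.castSucc).det := by
  simp [adjugate_fin_succ_eq_det_submatrix, Fin.succAbove_last, ← two_mul, pow_mul]

lemma det_of_mulVec_eq_single_last (hA : A *ᵥ u = Pi.single (Fin.last n) s)
    (hu : u (Fin.last n) = 1) :
    A.det = (A.submatrix Fin.castSucc Fin.castSucc).det * s := by
  have cramer : A.adjugate *ᵥ Pi.single (Fin.last n) s = A.det • u := by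
    rw [← hA, mulVec_mulVec, adjugate_mul, smul_mulVec, one_mulVec]
  simpa [mulVec_single, adjugate_last_last, hu] using (congrFun cramer (Fin.last n)).symm

/-- Column `last n` of the adjugate does not involve the last row of `A`, which may therefore be
replaced by `Pi.single i 1`. -/
lemma adjugate_last_of_mulVec_eq_single_last (hA : A *ᵥ u = Pi.single (Fin.last n) s)
    (hu : u (Fin.last n) = 1) (i : Fin (n + 1)) :
    A.adjugate i (Fin.last n) = (A.submatrix Fin.castSucc Fin.castSucc).det * u i := by
  have hA' : A.updateRow (Fin.last n) (Pi.single i 1) *ᵥ u = Pi.single (Fin.last n) (u i) := by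
    ext k
    refine Fin.lastCases ?_ (fun k => ?_) k
    · simp [mulVec]
    · simpa [mulVec, Fin.castSucc_ne_last] using congrFun hA k.castSucc
  rw [adjugate_apply, det_of_mulVec_eq_single_last hA' hu]
  congr 2
  ext k l
  simp [updateRow_ne, Fin.castSucc_ne_last]

end Bordering

section LeadingBlocks

variable {R : Type*}

/-- The leading `n × n` block of an infinite matrix. -/
def leadingBlock (e : ℕ → ℕ → R) (n : ℕ) : Matrix (Fin n) (Fin n) R := of fun i j => e i j

lemma leadingBlock_flip (e : ℕ → ℕ → R) (n : ℕ) :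
    leadingBlock (flip e) n = (leadingBlock e n)ᵀ := rfl

variable [CommRing R]

lemma leadingBlock_mulVec_snoc_castSucc (e : ℕ → ℕ → R) {n : ℕ} (y : Fin n → R) (c : R)
    (i : Fin n) :
    (leadingBlock e (n + 1) *ᵥ Fin.snoc (α := fun _ => R) y c) i.castSucc =
      (leadingBlock e n *ᵥ y) i + e i n * c := by
  simp [mulVec, dotProduct, leadingBlock, Fin.sum_univ_castSucc]

lemma leadingBlock_mulVec_snoc_last (e : ℕ → ℕ → R) {n : ℕ} (y : Fin n → R) (c : R) :
    (leadingBlock e (n + 1) *ᵥ Fin.snoc (α := fun _ => R) y c) (Fin.last n) =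
      ∑ j : Fin n, e n j * y j + e n n * c := by
  simp [mulVec, dotProduct, leadingBlock, Fin.sum_univ_castSucc]

/-- The minor of `leadingBlock e (n + 1)` obtained by deleting the first row and the first
column. -/
def coreMinor (e : ℕ → ℕ → R) (n : ℕ) : R := (leadingBlock (fun i j => e (i + 1) (j + 1)) n).det

lemma det_leadingBlock_flip (e : ℕ → ℕ → R) (n : ℕ) :
    (leadingBlock (flip e) n).det = (leadingBlock e n).det := by
  rw [leadingBlock_flip, det_transpose]

lemma adjugate_leadingBlock_zero_zero (e : ℕ → ℕ → R) (n : ℕ) :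
    (leadingBlock e (n + 1)).adjugate 0 0 = coreMinor e n := by
  simp only [adjugate_fin_succ_eq_det_submatrix, Fin.val_zero, add_zero, pow_zero, one_mul,
    Fin.succAbove_zero]
  rfl

/-- The infinite matrix obtained from `e` by adding `c` to the entry `(0, 0)`. -/
def addCorner (c : R) (e : ℕ → ℕ → R) (i j : ℕ) : R := e i j + if i = 0 ∧ j = 0 then c else 0

lemma addCorner_addCorner (c d : R) (e : ℕ → ℕ → R) :
    addCorner c (addCorner d e) = addCorner (d + c) e := by
  funext i j
  unfold addCorner
  split_ifs <;> ring

lemma addCorner_zero (e : ℕ → ℕ → R) : addCorner 0 e = e := by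
  funext i j
  simp [addCorner]

lemma coreMinor_addCorner (c : R) (e : ℕ → ℕ → R) (n : ℕ) :
    coreMinor (addCorner c e) n = coreMinor e n := by
  simp [coreMinor, addCorner]

lemma det_leadingBlock_addCorner (c : R) (e : ℕ → ℕ → R) (n : ℕ) :
    (leadingBlock (addCorner c e) (n + 1)).det =
      (leadingBlock e (n + 1)).det + c * coreMinor e n := by
  have update : leadingBlock (addCorner c e) (n + 1) =
      (leadingBlock e (n + 1)).updateRow 0
        (leadingBlock e (n + 1) 0 + c • Pi.single 0 1) := by
    ext i j
    refine Fin.cases ?_ (fun i => ?_) i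
    · simp [leadingBlock, addCorner, Pi.single_apply]
    · simp [leadingBlock, addCorner]
  rw [update, det_updateRow_add, det_updateRow_smul, updateRow_eq_self, ← adjugate_apply,
    adjugate_leadingBlock_zero_zero]

end LeadingBlocks

section Relations

variable {K : Type*} [Field K]

/-- The coefficients, normalised by a final `1`, of the linear combination of the columns
`0, …, n` of `e` that vanishes in the rows `0, …, n - 1`. It is only used if `leadingBlock e n` is
invertible. -/
noncomputable def colRelation (e : ℕ → ℕ → K) (n : ℕ) : Fin (n + 1) → K :=
  Fin.snoc (α := fun _ => K) (-((leadingBlock e n)⁻¹ *ᵥ fun i => e i n)) 1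

/-- The same as `colRelation` with the roles of rows and columns exchanged. -/
noncomputable def rowRelation (e : ℕ → ℕ → K) : (n : ℕ) → Fin (n + 1) → K := colRelation (flip e)

/-- The entry in row `n` of the combination `colRelation e n` of columns, that is, the Schur
complement of `leadingBlock e n` in `leadingBlock e (n + 1)`. -/
noncomputable def schur (e : ℕ → ℕ → K) (n : ℕ) : K :=
  ∑ j : Fin (n + 1), e n j * colRelation e n j

/-- The quotient `coreMinor e n / (leadingBlock e (n + 1)).det` at index `n + 1`; for
`e i j = ∑ s, X_s^(i) T_s^(j)` this is `v_{n + 1}`, and the value at `0` is the boundary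
value `v_0 = 0`. -/
noncomputable def quotient (e : ℕ → ℕ → K) : ℕ → K
  | 0 => 0
  | n + 1 => coreMinor e n / (leadingBlock e (n + 1)).det

variable {e : ℕ → ℕ → K} {n : ℕ}

lemma colRelation_last (e : ℕ → ℕ → K) (n : ℕ) : colRelation e n (Fin.last n) = 1 :=
  Fin.snoc_last _ _

lemma rowRelation_last (e : ℕ → ℕ → K) (n : ℕ) : rowRelation e n (Fin.last n) = 1 :=
  colRelation_last (flip e) n

lemma colRelation_castSucc (e : ℕ → ℕ → K) (n : ℕ) (i : Fin n) :
    colRelation e n i.castSucc = -((leadingBlock e n)⁻¹ *ᵥ fun i => e i n) i :=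
  Fin.snoc_castSucc (α := fun _ => K) _ _ _

lemma colRelation_zero_zero (e : ℕ → ℕ → K) : colRelation e 0 0 = 1 :=
  colRelation_last e 0

lemma sum_rowRelation_mul (e : ℕ → ℕ → K) (n : ℕ) (c : ℕ → K) :
    ∑ i : Fin (n + 1), rowRelation e n i * c i =
      c n - ∑ j : Fin n, e n j * ((leadingBlock e n)⁻¹ *ᵥ fun i => c i) j := by
  have row : ∀ i : Fin n, rowRelation e n i.castSucc =
      -((fun j : Fin n => e n j) ᵥ* (leadingBlock e n)⁻¹) i := fun i => by
    rw [rowRelation, colRelation_castSucc, leadingBlock_flip, ← transpose_nonsing_inv,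
      mulVec_transpose]
    rfl
  have pairing : ∑ j : Fin n, e n j * ((leadingBlock e n)⁻¹ *ᵥ fun i => c i) j =
      ∑ i : Fin n, ((fun j : Fin n => e n j) ᵥ* (leadingBlock e n)⁻¹) i * c i :=
    dotProduct_mulVec _ _ _
  rw [pairing, Fin.sum_univ_castSucc]
  simp [row, rowRelation_last, neg_add_eq_sub]

lemma leadingBlock_mulVec_colRelation (h : (leadingBlock e n).det ≠ 0) :
    leadingBlock e (n + 1) *ᵥ colRelation e n = Pi.single (Fin.last n) (schur e n) := by
  ext i
  refine Fin.lastCases ?_ (fun i => ?_) i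
  · simp [mulVec, dotProduct, leadingBlock, schur]
  · have solve : leadingBlock e n *ᵥ ((leadingBlock e n)⁻¹ *ᵥ fun i => e i n) =
        fun i : Fin n => e i n := by
      rw [mulVec_mulVec, mul_nonsing_inv _ h.isUnit, one_mulVec]
    rw [colRelation, leadingBlock_mulVec_snoc_castSucc, mulVec_neg, Pi.neg_apply, solve, mul_one,
      neg_add_cancel, Pi.single_eq_of_ne (Fin.castSucc_ne_last i)]

lemma sum_rowRelation_mul_col (h : (leadingBlock e n).det ≠ 0) (j : Fin n) :
    ∑ i : Fin (n + 1), rowRelation e n i * e i j = 0 := by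
  have entry := congrFun (leadingBlock_mulVec_colRelation (e := flip e) (n := n)
    (by rwa [det_leadingBlock_flip])) j.castSucc
  rw [Pi.single_eq_of_ne (Fin.castSucc_ne_last j)] at entry
  rw [← entry]
  exact Finset.sum_congr rfl fun i _ => mul_comm _ _

/-- Both sides are the value of the bilinear form `leadingBlock e (n + 1)` at the pair of
relations. -/
lemma schur_flip (h : (leadingBlock e n).det ≠ 0) : schur (flip e) n = schur e n := by
  have h' : (leadingBlock (flip e) n).det ≠ 0 := by rwa [det_leadingBlock_flip]
  calc schur (flip e) n
      = leadingBlock (flip e) (n + 1) *ᵥ rowRelation e n ⬝ᵥ colRelation e n := by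
        rw [rowRelation, leadingBlock_mulVec_colRelation h', single_dotProduct, colRelation_last,
          mul_one]
    _ = rowRelation e n ⬝ᵥ leadingBlock e (n + 1) *ᵥ colRelation e n := by
        rw [leadingBlock_flip, mulVec_transpose, dotProduct_mulVec]
    _ = schur e n := by
        rw [leadingBlock_mulVec_colRelation h, dotProduct_single, rowRelation, colRelation_last,
          one_mul]

lemma det_leadingBlock_succ (h : (leadingBlock e n).det ≠ 0) :
    (leadingBlock e (n + 1)).det = (leadingBlock e n).det * schur e n :=
  det_of_mulVec_eq_single_last (leadingBlock_mulVec_colRelation h) (colRelation_last e n)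

lemma schur_ne_zero (h : (leadingBlock e n).det ≠ 0) (h' : (leadingBlock e (n + 1)).det ≠ 0) :
    schur e n ≠ 0 := by
  rw [det_leadingBlock_succ h] at h'
  exact right_ne_zero_of_mul h'

lemma adjugate_leadingBlock_last (h : (leadingBlock e n).det ≠ 0) (i : Fin (n + 1)) :
    (leadingBlock e (n + 1)).adjugate i (Fin.last n) =
      (leadingBlock e n).det * colRelation e n i :=
  adjugate_last_of_mulVec_eq_single_last (leadingBlock_mulVec_colRelation h)
    (colRelation_last e n) i

lemma inv_leadingBlock_last (h : (leadingBlock e n).det ≠ 0) (i : Fin (n + 1)) :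
    (leadingBlock e (n + 1))⁻¹ i (Fin.last n) = colRelation e n i / schur e n := by
  rw [inv_def, Ring.inverse_eq_inv', Matrix.smul_apply, adjugate_leadingBlock_last h,
    det_leadingBlock_succ h, smul_eq_mul, inv_mul_eq_div, mul_div_mul_left _ _ h]

lemma inv_leadingBlock_last_zero (h : (leadingBlock e n).det ≠ 0) :
    (leadingBlock e (n + 1))⁻¹ (Fin.last n) 0 = rowRelation e n 0 / schur e n := by
  rw [← schur_flip h, rowRelation,
    ← inv_leadingBlock_last (e := flip e) (by rwa [det_leadingBlock_flip]) 0, leadingBlock_flip,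
    ← transpose_nonsing_inv, transpose_apply]

lemma inv_leadingBlock_zero_zero (e : ℕ → ℕ → K) (n : ℕ) :
    (leadingBlock e (n + 1))⁻¹ 0 0 = quotient e (n + 1) := by
  rw [inv_def, Ring.inverse_eq_inv', Matrix.smul_apply, adjugate_leadingBlock_zero_zero,
    smul_eq_mul, inv_mul_eq_div, quotient]

lemma quotient_flip (e : ℕ → ℕ → K) : ∀ n, quotient (flip e) n = quotient e n
  | 0 => rfl
  | n + 1 => by
    rw [← inv_leadingBlock_zero_zero, ← inv_leadingBlock_zero_zero, leadingBlock_flip,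
      ← transpose_nonsing_inv, transpose_apply]

lemma leadingBlock_mulVec_snoc_inv_zero (h : (leadingBlock e (n + 1)).det ≠ 0) :
    leadingBlock e (n + 2) *ᵥ
        Fin.snoc (α := fun _ => K) (fun k => (leadingBlock e (n + 1))⁻¹ k 0) 0 =
      Pi.single 0 1 - Pi.single (Fin.last (n + 1)) (rowRelation e (n + 1) 0) := by
  ext i
  refine Fin.lastCases ?_ (fun i => ?_) i
  · have row : rowRelation e (n + 1) 0 =
        -∑ k : Fin (n + 1), (leadingBlock e (n + 1))⁻¹ k 0 * e (n + 1) k := by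
      rw [rowRelation, ← Fin.castSucc_zero, colRelation_castSucc, leadingBlock_flip,
        ← transpose_nonsing_inv]
      rfl
    simp [leadingBlock_mulVec_snoc_last, row, mul_comm]
  · have solve : leadingBlock e (n + 1) *ᵥ (fun k => (leadingBlock e (n + 1))⁻¹ k 0) =
        Pi.single 0 1 := by
      ext i
      exact (congrFun₂ (mul_nonsing_inv _ h.isUnit) i 0).trans (by
        rw [one_apply, Pi.single_apply])
    simp [leadingBlock_mulVec_snoc_castSucc, solve, Pi.single_apply, Fin.castSucc_ne_last]

lemma coreMinor_eq (h : (leadingBlock e n).det ≠ 0) :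
    coreMinor e n = (leadingBlock e n).det *
      (schur e n * quotient e n + colRelation e n 0 * rowRelation e n 0) := by
  cases n with
  | zero => simp [coreMinor, quotient, rowRelation, colRelation_zero_zero]
  | succ n =>
    have cramer := congrFun (congrArg ((leadingBlock e (n + 2)).adjugate *ᵥ ·)
      (leadingBlock_mulVec_snoc_inv_zero h)) 0
    have snoc_zero : Fin.snoc (α := fun _ => K)
        (fun k => (leadingBlock e (n + 1))⁻¹ k 0) 0 0 = quotient e (n + 1) :=
      inv_leadingBlock_zero_zero e n
    simp only [mulVec_mulVec, adjugate_mul, smul_mulVec, one_mulVec, mulVec_sub, mulVec_single,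
      Pi.smul_apply, Pi.sub_apply, col_apply, smul_eq_mul, MulOpposite.smul_eq_mul_unop,
      MulOpposite.unop_op, adjugate_leadingBlock_zero_zero, adjugate_leadingBlock_last h,
      snoc_zero, det_leadingBlock_succ h] at cramer
    linear_combination -cramer

lemma quotient_succ (h : (leadingBlock e n).det ≠ 0) (hs : schur e n ≠ 0) :
    quotient e (n + 1) = quotient e n + colRelation e n 0 * rowRelation e n 0 / schur e n := by
  rw [quotient, coreMinor_eq h, det_leadingBlock_succ h, mul_div_mul_left _ _ h, add_div,
    mul_div_cancel_left₀ _ hs]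

end Relations

section InverseDerivative

lemma hasDerivAt_mulVec {𝕜 ι κ : Type*} [NontriviallyNormedField 𝕜] [Finite ι] [Fintype κ]
    {A : 𝕜 → Matrix ι κ 𝕜} {A' : Matrix ι κ 𝕜} {c : 𝕜 → κ → 𝕜} {c' : κ → 𝕜} {x : 𝕜}
    (hA : HasDerivAt A A' x) (hc : HasDerivAt c c' x) :
    HasDerivAt (fun y => A y *ᵥ c y) (A' *ᵥ c x + A x *ᵥ c') x := by
  have := Fintype.ofFinite ι
  refine hasDerivAt_pi.2 fun i => ?_
  have entries (j : κ) : HasDerivAt (fun y => A y i j) (A' i j) x :=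
    hasDerivAt_pi.1 (hasDerivAt_pi.1 hA i) j
  refine (HasDerivAt.fun_sum fun j _ => (entries j).mul (hasDerivAt_pi.1 hc j)).congr_deriv ?_
  exact Finset.sum_add_distrib

attribute [local instance] Matrix.linftyOpNormedRing Matrix.linftyOpNormedAlgebra

lemma hasDerivAt_matrix_inv {𝕜 ι : Type*} [NontriviallyNormedField 𝕜] [CompleteSpace 𝕜]
    [Fintype ι] [DecidableEq ι] {A : 𝕜 → Matrix ι ι 𝕜} {A' : Matrix ι ι 𝕜} {x : 𝕜}
    (hA : HasDerivAt A A' x) (hu : IsUnit (A x)) :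
    HasDerivAt (fun y => (A y)⁻¹) (-((A x)⁻¹ * A' * (A x)⁻¹)) x := by
  have : @CompleteSpace (Matrix ι ι 𝕜) PseudoMetricSpace.toUniformSpace :=
    inferInstanceAs (CompleteSpace (ι → ι → 𝕜))
  obtain ⟨u, hu⟩ := hu
  have inverse_deriv := hasFDerivAt_ringInverse (𝕜 := 𝕜) u
  rw [hu] at inverse_deriv
  refine (inverse_deriv.comp_hasDerivAt x hA).congr_deriv ?_ |>.congr_of_eventuallyEq ?_
  · simp [ContinuousLinearMap.mulLeftRight_apply, coe_units_inv, hu]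
  · exact .of_forall fun y => nonsing_inv_eq_ringInverse (A y)

end InverseDerivative

section RowShift

variable {𝕜 : Type*} [NontriviallyNormedField 𝕜] [CompleteSpace 𝕜]

lemma hasDerivAt_inv_mulVec {ι : Type*} [Fintype ι] [DecidableEq ι] {A : 𝕜 → Matrix ι ι 𝕜}
    {A' : Matrix ι ι 𝕜} {c : 𝕜 → ι → 𝕜} {c' : ι → 𝕜} {x : 𝕜}
    (hA : HasDerivAt A A' x) (hc : HasDerivAt c c' x) (hu : IsUnit (A x)) :
    HasDerivAt (fun y => (A y)⁻¹ *ᵥ c y) ((A x)⁻¹ *ᵥ (c' - A' *ᵥ ((A x)⁻¹ *ᵥ c x))) x := by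
  refine (hasDerivAt_mulVec (hasDerivAt_matrix_inv hA hu) hc).congr_deriv ?_
  rw [neg_mulVec, mulVec_sub, mulVec_mulVec, mulVec_mulVec, Matrix.mul_assoc, neg_add_eq_sub]

variable {a : 𝕜 → ℕ → ℕ → 𝕜} {x : 𝕜} {n : ℕ}

/-- Differentiation moves the rows of the linear system `leadingBlock a (n + 1) *ᵥ y = c` up by
one, so that only the last component of the residual survives. -/
lemma hasDerivAt_inv_leadingBlock_mulVec {c : 𝕜 → ℕ → 𝕜}
    (ha : ∀ i j, HasDerivAt (fun y => a y i j) (a x (i + 1) j) x)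
    (hc : ∀ i, HasDerivAt (fun y => c y i) (c x (i + 1)) x)
    (h : (leadingBlock (a x) (n + 1)).det ≠ 0) :
    HasDerivAt (fun y => (leadingBlock (a y) (n + 1))⁻¹ *ᵥ fun i => c y i)
      (fun k => (leadingBlock (a x) (n + 1))⁻¹ k (Fin.last n) *
        ∑ i : Fin (n + 2), rowRelation (a x) (n + 1) i * c x i) x := by
  set M := leadingBlock (a x) (n + 1)
  have hA : HasDerivAt (fun y => leadingBlock (a y) (n + 1))
      (of fun i j : Fin (n + 1) => a x (i + 1) j) x :=
    hasDerivAt_pi.2 fun i => hasDerivAt_pi.2 fun j => ha i j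
  have hc' : HasDerivAt (fun y => fun i : Fin (n + 1) => c y i) (fun i => c x (i + 1)) x :=
    hasDerivAt_pi.2 fun i => hc i
  have solve : M *ᵥ (M⁻¹ *ᵥ fun i => c x i) = fun i : Fin (n + 1) => c x i := by
    rw [mulVec_mulVec, mul_nonsing_inv _ h.isUnit, one_mulVec]
  have residual : ((fun i : Fin (n + 1) => c x (i + 1)) -
      (of fun i j : Fin (n + 1) => a x (i + 1) j) *ᵥ (M⁻¹ *ᵥ fun i => c x i)) =
      Pi.single (Fin.last n) (∑ i : Fin (n + 2), rowRelation (a x) (n + 1) i * c x i) := by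
    ext i
    refine Fin.lastCases ?_ (fun i => ?_) i
    · rw [Pi.single_eq_same, sum_rowRelation_mul]
      rfl
    · rw [Pi.single_eq_of_ne (Fin.castSucc_ne_last i)]
      exact sub_eq_zero.2 (congrFun solve i.succ).symm
  refine (hasDerivAt_inv_mulVec hA hc' ((isUnit_iff_isUnit_det _).2 h.isUnit)).congr_deriv ?_
  rw [residual]
  ext k
  simp [mulVec_single, M]

lemma hasDerivAt_inv_leadingBlock_zero
    (ha : ∀ i j, HasDerivAt (fun y => a y i j) (a x (i + 1) j) x)
    (h : (leadingBlock (a x) (n + 1)).det ≠ 0) (k : Fin (n + 1)) :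
    HasDerivAt (fun y => (leadingBlock (a y) (n + 1))⁻¹ k 0)
      ((leadingBlock (a x) (n + 1))⁻¹ k (Fin.last n) * rowRelation (a x) (n + 1) 0) x := by
  let unit : ℕ → 𝕜 := Pi.single 0 1
  have unit_deriv (i : ℕ) : HasDerivAt (fun _ : 𝕜 => unit i) (unit (i + 1)) x := by
    simpa [unit] using hasDerivAt_const x (unit i)
  have solution_deriv := hasDerivAt_pi.1
    (hasDerivAt_inv_leadingBlock_mulVec (c := fun _ => unit) ha unit_deriv h) k
  refine (solution_deriv.congr_deriv ?_).congr_of_eventuallyEq (.of_forall fun y => ?_)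
  · simp [unit, Fin.sum_univ_succ]
  · simp [unit, mulVec, dotProduct, Fin.sum_univ_succ]

lemma hasDerivAt_colRelation
    (ha : ∀ i j, HasDerivAt (fun y => a y i j) (a x (i + 1) j) x)
    (h : (leadingBlock (a x) (n + 1)).det ≠ 0) (k : Fin (n + 1)) :
    HasDerivAt (fun y => colRelation (a y) (n + 1) k.castSucc)
      (-((leadingBlock (a x) (n + 1))⁻¹ k (Fin.last n) * schur (a x) (n + 1))) x := by
  have solution_deriv := hasDerivAt_pi.1 (hasDerivAt_inv_leadingBlock_mulVec
    (c := fun y i => a y i (n + 1)) ha (fun i => ha i _) h) k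
  have pairing : ∑ i : Fin (n + 2), rowRelation (a x) (n + 1) i * a x i (n + 1) =
      schur (a x) (n + 1) := by
    rw [← schur_flip h, schur]
    exact Finset.sum_congr rfl fun i _ => mul_comm _ _
  simp only [colRelation_castSucc]
  exact solution_deriv.neg.congr_deriv (by rw [pairing])

lemma hasDerivAt_quotient
    (ha : ∀ i j, HasDerivAt (fun y => a y i j) (a x (i + 1) j) x)
    (h : (leadingBlock (a x) n).det ≠ 0) (h' : (leadingBlock (a x) (n + 1)).det ≠ 0) :
    HasDerivAt (fun y => quotient (a y) (n + 1))
      (colRelation (a x) n 0 * rowRelation (a x) (n + 1) 0 / schur (a x) n) x := by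
  simp only [← inv_leadingBlock_zero_zero]
  refine (hasDerivAt_inv_leadingBlock_zero ha h' 0).congr_deriv ?_
  rw [inv_leadingBlock_last h, div_mul_eq_mul_div]

lemma hasDerivAt_rowRelation_div_schur
    (ha : ∀ i j, HasDerivAt (fun y => a y i j) (a x (i + 1) j) x)
    (hB : ∀ᶠ y in 𝓝 x, (leadingBlock (a y) n).det ≠ 0)
    (h' : (leadingBlock (a x) (n + 1)).det ≠ 0) :
    HasDerivAt (fun y => rowRelation (a y) n 0 / schur (a y) n)
      (rowRelation (a x) (n + 1) 0 / schur (a x) n) x := by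
  have entry_deriv := hasDerivAt_inv_leadingBlock_zero ha h' (Fin.last n)
  rw [inv_leadingBlock_last hB.self_of_nhds, colRelation_last, one_div_mul_eq_div] at entry_deriv
  refine entry_deriv.congr_of_eventuallyEq ?_
  filter_upwards [hB] with y hy
  exact (inv_leadingBlock_last_zero hy).symm

end RowShift

section DerivArray

variable {𝕜 : Type*} [NontriviallyNormedField 𝕜] {I J : Set 𝕜} {a b : 𝕜 → 𝕜 → ℕ → ℕ → 𝕜}
  {x t : 𝕜} {n : ℕ}

/-- The entry `(i, j)` of the family `a` of infinite matrices is the partial derivative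
`∂_x^i ∂_t^j` of the entry `(0, 0)` on `I × J`. -/
structure IsDerivArray (I J : Set 𝕜) (a : 𝕜 → 𝕜 → ℕ → ℕ → 𝕜) : Prop where
  hasDerivAt_fst : ∀ ⦃x⦄, x ∈ I → ∀ ⦃t⦄, t ∈ J → ∀ i j,
    HasDerivAt (fun y => a y t i j) (a x t (i + 1) j) x
  hasDerivAt_snd : ∀ ⦃x⦄, x ∈ I → ∀ ⦃t⦄, t ∈ J → ∀ i j,
    HasDerivAt (fun s => a x s i j) (a x t i (j + 1)) t

namespace IsDerivArray

lemma flip (ha : IsDerivArray I J a) : IsDerivArray J I fun t x => flip (a x t) where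
  hasDerivAt_fst _ ht _ hx i j := ha.hasDerivAt_snd hx ht j i
  hasDerivAt_snd _ ht _ hx i j := ha.hasDerivAt_fst hx ht j i

lemma addCorner (ha : IsDerivArray I J a) (c : 𝕜) :
    IsDerivArray I J fun x t => addCorner c (a x t) where
  hasDerivAt_fst x hx t ht i j := by
    simpa [FSY.addCorner] using ha.hasDerivAt_fst hx ht i j
  hasDerivAt_snd x hx t ht i j := by
    simpa [FSY.addCorner] using ha.hasDerivAt_snd hx ht i j

lemma eq_of_zero_zero_eq (hI : IsOpen I) (hJ : IsOpen J) (ha : IsDerivArray I J a)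
    (hb : IsDerivArray I J b) (h : ∀ x ∈ I, ∀ t ∈ J, a x t 0 0 = b x t 0 0)
    (hx : x ∈ I) (ht : t ∈ J) : a x t = b x t := by
  have first_row (j : ℕ) : ∀ x ∈ I, ∀ t ∈ J, a x t 0 j = b x t 0 j := by
    induction j with
    | zero => exact h
    | succ j ih =>
      refine fun x hx t ht => (ha.hasDerivAt_snd hx ht 0 j).unique ?_
      refine (hb.hasDerivAt_snd hx ht 0 j).congr_of_eventuallyEq ?_
      filter_upwards [hJ.mem_nhds ht] with s hs using ih x hx s hs
  have rows (i j : ℕ) : ∀ x ∈ I, ∀ t ∈ J, a x t i j = b x t i j := by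
    induction i with
    | zero => exact first_row j
    | succ i ih =>
      refine fun x hx t ht => (ha.hasDerivAt_fst hx ht i j).unique ?_
      refine (hb.hasDerivAt_fst hx ht i j).congr_of_eventuallyEq ?_
      filter_upwards [hI.mem_nhds hx] with y hy using ih y hy t ht
  funext i j
  exact rows i j x hx t ht

variable [CompleteSpace 𝕜]

lemma hasDerivAt_quotient_fst (ha : IsDerivArray I J a) (hx : x ∈ I) (ht : t ∈ J)
    (h : (leadingBlock (a x t) n).det ≠ 0) (h' : (leadingBlock (a x t) (n + 1)).det ≠ 0) :
    HasDerivAt (fun y => quotient (a y t) (n + 1))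
      (colRelation (a x t) n 0 * rowRelation (a x t) (n + 1) 0 / schur (a x t) n) x :=
  hasDerivAt_quotient (ha.hasDerivAt_fst hx ht) h h'

lemma hasDerivAt_quotient_snd (ha : IsDerivArray I J a) (hx : x ∈ I) (ht : t ∈ J)
    (h : (leadingBlock (a x t) n).det ≠ 0) (h' : (leadingBlock (a x t) (n + 1)).det ≠ 0) :
    HasDerivAt (fun s => quotient (a x s) (n + 1))
      (rowRelation (a x t) n 0 * colRelation (a x t) (n + 1) 0 / schur (a x t) n) t := by
  have flipped := ha.flip.hasDerivAt_quotient_fst (n := n) ht hx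
    (by rwa [det_leadingBlock_flip]) (by rwa [det_leadingBlock_flip])
  simp only [quotient_flip, schur_flip h] at flipped
  exact flipped

lemma hasDerivAt_quotient_mixed (ha : IsDerivArray I J a) (hI : IsOpen I) (hx : x ∈ I)
    (ht : t ∈ J) (h : ∀ y ∈ I, (leadingBlock (a y t) n).det ≠ 0)
    (h' : (leadingBlock (a x t) (n + 1)).det ≠ 0) :
    HasDerivAt (fun y => rowRelation (a y t) n 0 * colRelation (a y t) (n + 1) 0 / schur (a y t) n)
      (colRelation (a x t) (n + 1) 0 * rowRelation (a x t) (n + 1) 0 / schur (a x t) n -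
        colRelation (a x t) n 0 * rowRelation (a x t) n 0 * schur (a x t) (n + 1) /
          schur (a x t) n ^ 2) x := by
  have ha_fst := ha.hasDerivAt_fst hx ht
  have left := hasDerivAt_rowRelation_div_schur ha_fst
    (Filter.mem_of_superset (hI.mem_nhds hx) h) h'
  have right := hasDerivAt_colRelation ha_fst h' 0
  rw [inv_leadingBlock_last (h x hx)] at right
  refine ((left.mul right).congr_of_eventuallyEq (.of_forall fun y => ?_)).congr_deriv ?_
  · exact (div_mul_eq_mul_div _ _ _).symm
  · simp only [Fin.castSucc_zero]
    field_simp
    ring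

end IsDerivArray

end DerivArray

section SmoothFunctions

variable {𝕜 F : Type*} [NontriviallyNormedField 𝕜] [NormedAddCommGroup F] [NormedSpace 𝕜 F]
  {I : Set 𝕜} {f : 𝕜 → F}

lemma contDiffOn_iteratedDeriv (hI : IsOpen I) (hf : ContDiffOn 𝕜 ∞ f I) (n : ℕ) :
    ContDiffOn 𝕜 ∞ (iteratedDeriv n f) I := by
  induction n with
  | zero => simpa using hf
  | succ n ih =>
    rw [iteratedDeriv_succ]
    exact ((contDiffOn_infty_iff_deriv_of_isOpen hI).1 ih).2

lemma hasDerivAt_iteratedDeriv {x : 𝕜} (hI : IsOpen I) (hf : ContDiffOn 𝕜 ∞ f I)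
    (n : ℕ) (hx : x ∈ I) : HasDerivAt (iteratedDeriv n f) (iteratedDeriv (n + 1) f x) x := by
  rw [iteratedDeriv_succ]
  exact (((contDiffOn_iteratedDeriv hI hf n).differentiableOn (by simp)).differentiableAt
    (hI.mem_nhds hx)).hasDerivAt

lemma contDiffOn_of_hasDerivAt_succ {f : ℕ → 𝕜 → F} (hI : IsOpen I)
    (hf : ∀ i, ∀ x ∈ I, HasDerivAt (f i) (f (i + 1) x) x) (i : ℕ) : ContDiffOn 𝕜 ∞ (f i) I := by
  rw [contDiffOn_infty]
  intro k
  induction k generalizing i with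
  | zero => exact contDiffOn_zero.2 fun x hx => (hf i x hx).continuousAt.continuousWithinAt
  | succ k ih =>
    rw [Nat.cast_add, Nat.cast_one]
    refine (contDiffOn_succ_iff_deriv_of_isOpen hI).2 ⟨fun x hx =>
      (hf i x hx).differentiableAt.differentiableWithinAt,
      fun h => (WithTop.coe_ne_top h).elim, ?_⟩
    exact (ih (i + 1)).congr fun x hx => (hf i x hx).deriv

lemma contDiffOn_det {𝕜 E R ι : Type*} [NontriviallyNormedField 𝕜] [NormedAddCommGroup E]
    [NormedSpace 𝕜 E] [NormedCommRing R] [NormedAlgebra 𝕜 R] [Fintype ι] [DecidableEq ι]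
    {k : WithTop ℕ∞} {S : Set E} {M : E → Matrix ι ι R}
    (hM : ∀ i j, ContDiffOn 𝕜 k (fun p => M p i j) S) :
    ContDiffOn 𝕜 k (fun p => (M p).det) S := by
  simp only [det_apply]
  exact ContDiffOn.sum fun σ _ => (contDiffOn_prod fun i _ => hM _ _).const_smul _

lemma eq_of_hasDerivAt_zero {𝕜 F : Type*} [RCLike 𝕜] [NormedAddCommGroup F]
    [NormedSpace 𝕜 F] {S : Set 𝕜} {f : 𝕜 → F} {x y : 𝕜} (hS : IsOpen S)
    (hS' : IsPreconnected S) (hf : ∀ z ∈ S, HasDerivAt f 0 z) (hx : x ∈ S) (hy : y ∈ S) :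
    f x = f y :=
  hS.is_const_of_deriv_eq_zero hS'
    (fun z hz => (hf z hz).differentiableAt.differentiableWithinAt) (fun z hz => (hf z hz).deriv)
    hx hy

end SmoothFunctions

section SeparableKernel

variable {𝕜 : Type*} [RCLike 𝕜] {I J : Set 𝕜} {m : ℕ} {X T : Fin m → 𝕜 → 𝕜}

/-- The matrix `∑ s, X_s^(i)(x) T_s^(j)(t)` of the partial derivatives of the kernel
`∑ s, X_s(x) T_s(t)`. -/
noncomputable def kernelArray (X T : Fin m → 𝕜 → 𝕜) (x t : 𝕜) (i j : ℕ) : 𝕜 :=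
  ∑ s, iteratedDeriv i (X s) x * iteratedDeriv j (T s) t

lemma detB_eq (X T : Fin m → 𝕜 → 𝕜) (n : ℕ) (x t : 𝕜) :
    detB X T n x t = (leadingBlock (kernelArray X T x t) n).det := rfl

lemma detA_succ_eq (X T : Fin m → 𝕜 → 𝕜) (n : ℕ) (x t : 𝕜) :
    detA X T (n + 1) x t = coreMinor (kernelArray X T x t) n := rfl

lemma detB_succ_eq_zero (X T : Fin m → 𝕜 → 𝕜) (x t : 𝕜) : detB X T (m + 1) x t = 0 := by
  let A : Matrix (Fin (m + 1)) (Fin m) 𝕜 := of fun k s => iteratedDeriv k (X s) x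
  let B : Matrix (Fin m) (Fin (m + 1)) 𝕜 := of fun s l => iteratedDeriv l (T s) t
  by_contra det_ne_zero
  have unit : IsUnit (A * B) := (isUnit_iff_isUnit_det _).2 (Ne.isUnit det_ne_zero)
  have rank_le := (rank_mul_le_left A B).trans (rank_le_width A)
  rw [rank_of_isUnit _ unit, Fintype.card_fin] at rank_le
  omega

lemma isDerivArray_kernelArray (hI : IsOpen I) (hJ : IsOpen J)
    (hX : ∀ s, ContDiffOn 𝕜 ∞ (X s) I) (hT : ∀ s, ContDiffOn 𝕜 ∞ (T s) J) :
    IsDerivArray I J (kernelArray X T) where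
  hasDerivAt_fst _ hx _ _ i _ :=
    HasDerivAt.fun_sum fun s _ => (hasDerivAt_iteratedDeriv hI (hX s) i hx).mul_const _
  hasDerivAt_snd _ _ _ ht _ j :=
    HasDerivAt.fun_sum fun s _ => (hasDerivAt_iteratedDeriv hJ (hT s) j ht).const_mul _

lemma contDiffOn_kernelArray (hI : IsOpen I) (hJ : IsOpen J) (hX : ∀ s, ContDiffOn 𝕜 ∞ (X s) I)
    (hT : ∀ s, ContDiffOn 𝕜 ∞ (T s) J) (i j : ℕ) :
    ContDiffOn 𝕜 ∞ (fun p : 𝕜 × 𝕜 => kernelArray X T p.1 p.2 i j) (I ×ˢ J) :=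
  ContDiffOn.sum fun s _ =>
    ((contDiffOn_iteratedDeriv hI (hX s) i).comp contDiffOn_fst fun _ hp => hp.1).mul
      ((contDiffOn_iteratedDeriv hJ (hT s) j).comp contDiffOn_snd fun _ hp => hp.2)

lemma contDiffOn_detB (hI : IsOpen I) (hJ : IsOpen J) (hX : ∀ s, ContDiffOn 𝕜 ∞ (X s) I)
    (hT : ∀ s, ContDiffOn 𝕜 ∞ (T s) J) (n : ℕ) :
    ContDiffOn 𝕜 ∞ (fun p : 𝕜 × 𝕜 => detB X T n p.1 p.2) (I ×ˢ J) :=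
  contDiffOn_det fun i j => contDiffOn_kernelArray hI hJ hX hT i j

lemma contDiffOn_detA (hI : IsOpen I) (hJ : IsOpen J) (hX : ∀ s, ContDiffOn 𝕜 ∞ (X s) I)
    (hT : ∀ s, ContDiffOn 𝕜 ∞ (T s) J) (n : ℕ) :
    ContDiffOn 𝕜 ∞ (fun p : 𝕜 × 𝕜 => detA X T n p.1 p.2) (I ×ˢ J) :=
  contDiffOn_det fun i j => contDiffOn_kernelArray hI hJ hX hT (i + 1) (j + 1)

namespace IsDerivArray

variable {a : 𝕜 → 𝕜 → ℕ → ℕ → 𝕜} {n : ℕ} {x x₀ t t₀ : 𝕜}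

lemma rowRelation_eq_of_schur_eq_zero (ha : IsDerivArray I J a) (hJ : IsOpen J)
    (hJ' : IsPreconnected J) (hx : x ∈ I) (hB : ∀ t ∈ J, (leadingBlock (a x t) (n + 1)).det ≠ 0)
    (hs : ∀ t ∈ J, schur (a x t) (n + 1) = 0) (ht : t ∈ J) (ht₀ : t₀ ∈ J) :
    rowRelation (a x t) (n + 1) = rowRelation (a x t₀) (n + 1) := by
  ext k
  refine Fin.lastCases (by simp only [rowRelation_last]) (fun k => ?_) k
  refine eq_of_hasDerivAt_zero (f := fun s => rowRelation (a x s) (n + 1) k.castSucc) hJ hJ'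
    (fun s hsJ => ?_) ht ht₀
  refine (hasDerivAt_colRelation (ha.flip.hasDerivAt_fst hsJ hx)
    (by rw [det_leadingBlock_flip]; exact hB s hsJ) k).congr_deriv ?_
  rw [schur_flip (hB s hsJ), hs s hsJ, mul_zero, neg_zero]

/-- The derivative in `x` is the pairing of the first column at `(x, t)` with the row relation at
`(x, t₀)`; the latter is also the row relation at `(x, t)`, hence the pairing is zero. -/
lemma inv_mulVec_eq_of_schur_eq_zero (ha : IsDerivArray I J a) (hI : IsOpen I)
    (hI' : IsPreconnected I) (hJ : IsOpen J) (hJ' : IsPreconnected J)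
    (hB : ∀ x ∈ I, ∀ t ∈ J, (leadingBlock (a x t) (n + 1)).det ≠ 0)
    (hs : ∀ x ∈ I, ∀ t ∈ J, schur (a x t) (n + 1) = 0) (hx : x ∈ I) (hx₀ : x₀ ∈ I) (ht : t ∈ J)
    (ht₀ : t₀ ∈ J) :
    ((leadingBlock (a x t₀) (n + 1))⁻¹ *ᵥ fun i => a x t i 0) =
      (leadingBlock (a x₀ t₀) (n + 1))⁻¹ *ᵥ fun i => a x₀ t i 0 := by
  ext k
  refine eq_of_hasDerivAt_zero
    (f := fun y => ((leadingBlock (a y t₀) (n + 1))⁻¹ *ᵥ fun i => a y t i 0) k) hI hI'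
    (fun y hy => ?_) hx hx₀
  refine (hasDerivAt_pi.1 (hasDerivAt_inv_leadingBlock_mulVec (c := fun y i => a y t i 0)
    (ha.hasDerivAt_fst hy ht₀) (fun i => ha.hasDerivAt_fst hy ht i 0) (hB y hy t₀ ht₀))
    k).congr_deriv ?_
  have pairing : ∑ i : Fin (n + 2), rowRelation (a y t) (n + 1) i * a y t i 0 = 0 :=
    sum_rowRelation_mul_col (hB y hy t ht) 0
  rw [← ha.rowRelation_eq_of_schur_eq_zero hJ hJ' hy (hB y hy) (hs y hy) ht ht₀, pairing, mul_zero]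

/-- Row `0` of `a x t₀` times the solution of the system with right-hand side the first column of
`a x t` is `a x t 0 0`. The solution does not depend on `x`, the row does not depend on `t`. -/
lemma exists_eq_kernelArray (ha : IsDerivArray I J a) (hI : IsOpen I) (hI' : IsPreconnected I)
    (hJ : IsOpen J) (hJ' : IsPreconnected J)
    (hB : ∀ x ∈ I, ∀ t ∈ J, (leadingBlock (a x t) (n + 1)).det ≠ 0)
    (hB' : ∀ x ∈ I, ∀ t ∈ J, (leadingBlock (a x t) (n + 2)).det = 0) :
    ∃ X T : Fin (n + 1) → 𝕜 → 𝕜,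
      (∀ s, ContDiffOn 𝕜 ∞ (X s) I) ∧ (∀ s, ContDiffOn 𝕜 ∞ (T s) J) ∧
      ∀ x ∈ I, ∀ t ∈ J, a x t = kernelArray X T x t := by
  rcases (I ×ˢ J).eq_empty_or_nonempty with hIJ | ⟨⟨x₀, t₀⟩, hx₀, ht₀⟩
  · exact ⟨fun _ _ => 0, fun _ _ => 0, fun _ => contDiffOn_const, fun _ => contDiffOn_const,
      fun x hx t ht => (hIJ.subset (Set.mk_mem_prod hx ht)).elim⟩
  have hs : ∀ x ∈ I, ∀ t ∈ J, schur (a x t) (n + 1) = 0 := fun x hx t ht => by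
    simpa [det_leadingBlock_succ (hB x hx t ht), hB x hx t ht] using hB' x hx t ht
  let X (s : Fin (n + 1)) (x : 𝕜) : 𝕜 := a x t₀ 0 s
  let T (s : Fin (n + 1)) (t : 𝕜) : 𝕜 :=
    ((leadingBlock (a x₀ t₀) (n + 1))⁻¹ *ᵥ fun i => a x₀ t i 0) s
  have hX (s) : ContDiffOn 𝕜 ∞ (X s) I := contDiffOn_of_hasDerivAt_succ hI
    (f := fun i x => a x t₀ i s) (fun i x hx => ha.hasDerivAt_fst hx ht₀ i s) 0
  have hT (s) : ContDiffOn 𝕜 ∞ (T s) J := by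
    simp only [T, mulVec, dotProduct]
    exact ContDiffOn.sum fun i _ => contDiffOn_const.mul (contDiffOn_of_hasDerivAt_succ hJ
      (f := fun j t => a x₀ t i j) (fun j t ht => ha.hasDerivAt_snd hx₀ ht i j) 0)
  refine ⟨X, T, hX, hT, fun x hx t ht =>
    eq_of_zero_zero_eq hI hJ ha (isDerivArray_kernelArray hI hJ hX hT) (fun x hx t ht => ?_) hx ht⟩
  calc a x t 0 0
      = (leadingBlock (a x t₀) (n + 1) *ᵥ
          ((leadingBlock (a x t₀) (n + 1))⁻¹ *ᵥ fun i => a x t i 0)) 0 := by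
        rw [mulVec_mulVec, mul_nonsing_inv _ (hB x hx t₀ ht₀).isUnit, one_mulVec, Fin.val_zero]
    _ = ∑ s, X s x * T s t := by
        rw [ha.inv_mulVec_eq_of_schur_eq_zero hI hI' hJ hJ' hB hs hx hx₀ ht ht₀]
        rfl
    _ = kernelArray X T x t 0 0 := by simp only [kernelArray, iteratedDeriv_zero]

end IsDerivArray

end SeparableKernel

section PartialDerivatives

variable {𝕜 : Type*} [RCLike 𝕜] {Ω : Set (𝕜 × 𝕜)} {f g : 𝕜 → 𝕜 → 𝕜} {x t : 𝕜}

lemma hasDerivAt_fst_of_contDiffOn (hΩ : IsOpen Ω)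
    (hf : ContDiffOn 𝕜 ∞ (fun p : 𝕜 × 𝕜 => f p.1 p.2) Ω) (hxt : (x, t) ∈ Ω) :
    HasDerivAt (fun y => f y t) (fderiv 𝕜 (fun p : 𝕜 × 𝕜 => f p.1 p.2) (x, t) (1, 0)) x :=
  (((hf.differentiableOn (by simp)).differentiableAt (hΩ.mem_nhds hxt)).hasFDerivAt
    ).comp_hasDerivAt (f := fun y => (y, t)) x ((hasDerivAt_id x).prodMk (hasDerivAt_const x t))

lemma hasDerivAt_snd_of_contDiffOn (hΩ : IsOpen Ω)
    (hf : ContDiffOn 𝕜 ∞ (fun p : 𝕜 × 𝕜 => f p.1 p.2) Ω) (hxt : (x, t) ∈ Ω) :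
    HasDerivAt (fun s => f x s) (fderiv 𝕜 (fun p : 𝕜 × 𝕜 => f p.1 p.2) (x, t) (0, 1)) t :=
  (((hf.differentiableOn (by simp)).differentiableAt (hΩ.mem_nhds hxt)).hasFDerivAt
    ).comp_hasDerivAt (f := fun s => (x, s)) t ((hasDerivAt_const t x).prodMk (hasDerivAt_id t))

lemma eqOn_dx_fderiv (hΩ : IsOpen Ω) (hf : ContDiffOn 𝕜 ∞ (fun p : 𝕜 × 𝕜 => f p.1 p.2) Ω) :
    Set.EqOn (fun p => dx f p.1 p.2) (fun p => fderiv 𝕜 (fun p : 𝕜 × 𝕜 => f p.1 p.2) p (1, 0)) Ω :=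
  fun _ hp => (hasDerivAt_fst_of_contDiffOn hΩ hf hp).deriv

lemma eqOn_dt_fderiv (hΩ : IsOpen Ω) (hf : ContDiffOn 𝕜 ∞ (fun p : 𝕜 × 𝕜 => f p.1 p.2) Ω) :
    Set.EqOn (fun p => dt f p.1 p.2) (fun p => fderiv 𝕜 (fun p : 𝕜 × 𝕜 => f p.1 p.2) p (0, 1)) Ω :=
  fun _ hp => (hasDerivAt_snd_of_contDiffOn hΩ hf hp).deriv

lemma contDiffOn_dx (hΩ : IsOpen Ω) (hf : ContDiffOn 𝕜 ∞ (fun p : 𝕜 × 𝕜 => f p.1 p.2) Ω) :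
    ContDiffOn 𝕜 ∞ (fun p : 𝕜 × 𝕜 => dx f p.1 p.2) Ω :=
  ((hf.fderiv_of_isOpen hΩ (by simp)).clm_apply contDiffOn_const).congr (eqOn_dx_fderiv hΩ hf)

lemma contDiffOn_dt (hΩ : IsOpen Ω) (hf : ContDiffOn 𝕜 ∞ (fun p : 𝕜 × 𝕜 => f p.1 p.2) Ω) :
    ContDiffOn 𝕜 ∞ (fun p : 𝕜 × 𝕜 => dt f p.1 p.2) Ω :=
  ((hf.fderiv_of_isOpen hΩ (by simp)).clm_apply contDiffOn_const).congr (eqOn_dt_fderiv hΩ hf)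

lemma dt_dx_comm (hΩ : IsOpen Ω) (hf : ContDiffOn 𝕜 ∞ (fun p : 𝕜 × 𝕜 => f p.1 p.2) Ω)
    (hxt : (x, t) ∈ Ω) : dt (dx f) x t = dx (dt f) x t := by
  set F : 𝕜 × 𝕜 → 𝕜 := fun p => f p.1 p.2
  have fderiv_apply (u v : 𝕜 × 𝕜) :
      fderiv 𝕜 (fun p => fderiv 𝕜 F p u) (x, t) v = fderiv 𝕜 (fderiv 𝕜 F) (x, t) v u := by
    have diff : DifferentiableAt 𝕜 (fderiv 𝕜 F) (x, t) :=
      ((hf.fderiv_of_isOpen (m := ∞) hΩ (by simp)).differentiableOn (by simp)).differentiableAt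
        (hΩ.mem_nhds hxt)
    simp [fderiv_clm_apply diff (differentiableAt_const u)]
  have symm := (hf.contDiffAt (hΩ.mem_nhds hxt)).isSymmSndFDerivAt (by
    rw [minSmoothness_of_isRCLikeNormedField]
    exact WithTop.coe_le_coe.2 le_top)
  calc dt (dx f) x t
      = fderiv 𝕜 (fun p => fderiv 𝕜 F p (1, 0)) (x, t) (0, 1) := by
        rw [← ((eqOn_dx_fderiv hΩ hf).eventuallyEq_of_mem (hΩ.mem_nhds hxt)).fderiv_eq]
        exact eqOn_dt_fderiv hΩ (contDiffOn_dx hΩ hf) hxt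
    _ = fderiv 𝕜 (fun p => fderiv 𝕜 F p (0, 1)) (x, t) (1, 0) := by
        rw [fderiv_apply, fderiv_apply, symm.eq]
    _ = dx (dt f) x t := by
        rw [← ((eqOn_dt_fderiv hΩ hf).eventuallyEq_of_mem (hΩ.mem_nhds hxt)).fderiv_eq]
        exact (eqOn_dx_fderiv hΩ (contDiffOn_dt hΩ hf) hxt).symm

lemma dx_congr (hΩ : IsOpen Ω) (h : ∀ p ∈ Ω, f p.1 p.2 = g p.1 p.2) (hxt : (x, t) ∈ Ω) :
    dx f x t = dx g x t := by
  refine Filter.EventuallyEq.deriv_eq ?_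
  filter_upwards [(hΩ.preimage (by fun_prop : Continuous fun y : 𝕜 => (y, t))).mem_nhds hxt]
    with y hy using h _ hy

lemma contDiffOn_iterate_dx (hΩ : IsOpen Ω)
    (hf : ContDiffOn 𝕜 ∞ (fun p : 𝕜 × 𝕜 => f p.1 p.2) Ω) (i : ℕ) :
    ContDiffOn 𝕜 ∞ (fun p : 𝕜 × 𝕜 => dx^[i] f p.1 p.2) Ω :=
  Function.Iterate.rec (fun g : 𝕜 → 𝕜 → 𝕜 => ContDiffOn 𝕜 ∞ (fun p : 𝕜 × 𝕜 => g p.1 p.2) Ω)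
    hf (fun _ => contDiffOn_dx hΩ) i

lemma contDiffOn_iterate_dt (hΩ : IsOpen Ω)
    (hf : ContDiffOn 𝕜 ∞ (fun p : 𝕜 × 𝕜 => f p.1 p.2) Ω) (j : ℕ) :
    ContDiffOn 𝕜 ∞ (fun p : 𝕜 × 𝕜 => dt^[j] f p.1 p.2) Ω :=
  Function.Iterate.rec (fun g : 𝕜 → 𝕜 → 𝕜 => ContDiffOn 𝕜 ∞ (fun p : 𝕜 × 𝕜 => g p.1 p.2) Ω)
    hf (fun _ => contDiffOn_dt hΩ) j

lemma dt_iterate_dx (hΩ : IsOpen Ω) (hf : ContDiffOn 𝕜 ∞ (fun p : 𝕜 × 𝕜 => f p.1 p.2) Ω)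
    (i : ℕ) : ∀ p ∈ Ω, dt (dx^[i] f) p.1 p.2 = dx^[i] (dt f) p.1 p.2 := by
  induction i with
  | zero => exact fun _ _ => rfl
  | succ i ih =>
    intro p hp
    simp only [Function.iterate_succ_apply']
    rw [dt_dx_comm hΩ (contDiffOn_iterate_dx hΩ hf i) hp, dx_congr hΩ ih hp]

lemma isDerivArray_iterate {I J : Set 𝕜} (hI : IsOpen I) (hJ : IsOpen J)
    (hf : ContDiffOn 𝕜 ∞ (fun p : 𝕜 × 𝕜 => f p.1 p.2) (I ×ˢ J)) :
    IsDerivArray I J fun x t i j => dx^[i] (dt^[j] f) x t where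
  hasDerivAt_fst x hx t ht i j := by
    have smooth := contDiffOn_iterate_dx (hI.prod hJ) (contDiffOn_iterate_dt (hI.prod hJ) hf j) i
    simp only [Function.iterate_succ_apply']
    exact (hasDerivAt_fst_of_contDiffOn (hI.prod hJ) smooth ⟨hx, ht⟩).differentiableAt.hasDerivAt
  hasDerivAt_snd x hx t ht i j := by
    have smooth := contDiffOn_iterate_dx (hI.prod hJ) (contDiffOn_iterate_dt (hI.prod hJ) hf j) i
    rw [Function.iterate_succ_apply', ← dt_iterate_dx (hI.prod hJ)
      (contDiffOn_iterate_dt (hI.prod hJ) hf j) i (x, t) ⟨hx, ht⟩]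
    exact (hasDerivAt_snd_of_contDiffOn (hI.prod hJ) smooth ⟨hx, ht⟩).differentiableAt.hasDerivAt

end PartialDerivatives

section Lattice

variable {K : Type*} {N n : ℕ} {c : K} {b : OnePoint K} {φ : ℕ → K → K → K} {x t : K}

lemma site_zero (N : ℕ) (c : K) (b : OnePoint K) (φ : ℕ → K → K → K) (x t : K) :
    site N c b φ 0 x t = c := if_pos rfl

lemma site_succ_of_lt (hn : n + 1 < N) : site N c b φ (n + 1) x t = φ (n + 1) x t := by
  rw [site, if_neg n.succ_ne_zero, if_pos hn]

lemma site_self (n : ℕ) (c : K) (b : OnePoint K) (φ : ℕ → K → K → K) (x t : K) :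
    site (n + 1) c b φ (n + 1) x t = b := by
  rw [site, if_neg n.succ_ne_zero, if_neg (lt_irrefl _)]

variable {𝕜 : Type*} [RCLike 𝕜]

lemma recipDiff_coe (p q : 𝕜) : recipDiff (p : OnePoint 𝕜) (q : OnePoint 𝕜) = 1 / (p - q) := rfl

lemma recipDiff_infty (q : OnePoint 𝕜) : recipDiff OnePoint.infty q = 0 := by
  cases q <;> rfl

end Lattice

section Represents

variable {𝕜 : Type*} [RCLike 𝕜] {N n : ℕ} {c : 𝕜} {b : OnePoint 𝕜} {I J : Set 𝕜}
  {φ : ℕ → 𝕜 → 𝕜 → 𝕜} {a : 𝕜 → 𝕜 → ℕ → ℕ → 𝕜} {x t : 𝕜}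

/-- On `I × J` the lattice value at site `n` is the translate by the boundary value `c` of the
quotient of minors of the matrices `a x t`, the denominator being nowhere zero. -/
def Represents (N : ℕ) (c : 𝕜) (b : OnePoint 𝕜) (I J : Set 𝕜) (φ : ℕ → 𝕜 → 𝕜 → 𝕜)
    (a : 𝕜 → 𝕜 → ℕ → ℕ → 𝕜) (n : ℕ) : Prop :=
  ∀ x ∈ I, ∀ t ∈ J, (leadingBlock (a x t) n).det ≠ 0 ∧
    site N c b φ n x t = ((quotient (a x t) n + c : 𝕜) : OnePoint 𝕜)

/-- The relation to which the lattice equation at site `n` is equivalent if `a` represents the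
sites `n - 1` and `n`. -/
def SiteRelation (N : ℕ) (c : 𝕜) (b : OnePoint 𝕜) (φ : ℕ → 𝕜 → 𝕜 → 𝕜)
    (a : 𝕜 → 𝕜 → ℕ → ℕ → 𝕜) (n : ℕ) (x t : 𝕜) : Prop :=
  recipDiff (site N c b φ (n + 1) x t) (site N c b φ n x t) *
    (colRelation (a x t) n 0 * rowRelation (a x t) n 0) = schur (a x t) n

namespace Represents

lemma zero : Represents N c b I J φ a 0 := fun x _ t _ =>
  ⟨by simp, by rw [site_zero, quotient, zero_add]⟩

lemma succ_iff (hn : n + 1 < N) : Represents N c b I J φ a (n + 1) ↔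
    ∀ x ∈ I, ∀ t ∈ J, (leadingBlock (a x t) (n + 1)).det ≠ 0 ∧
      φ (n + 1) x t = quotient (a x t) (n + 1) + c := by
  simp only [Represents, site_succ_of_lt hn, OnePoint.coe_eq_coe]

lemma relations_ne_zero (h : Represents N c b I J φ a n) (h' : Represents N c b I J φ a (n + 1))
    (hx : x ∈ I) (ht : t ∈ J) (hne : site N c b φ n x t ≠ site N c b φ (n + 1) x t) :
    colRelation (a x t) n 0 ≠ 0 ∧ rowRelation (a x t) n 0 ≠ 0 := by
  rw [← mul_ne_zero_iff]
  intro vanish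
  apply hne
  have hB := (h x hx t ht).1
  rw [(h x hx t ht).2, (h' x hx t ht).2,
    quotient_succ hB (schur_ne_zero hB (h' x hx t ht).1), vanish, zero_div, add_zero]

lemma siteRelation (h : Represents N c b I J φ a n) (h' : Represents N c b I J φ a (n + 1))
    (hx : x ∈ I) (ht : t ∈ J) (hne : site N c b φ n x t ≠ site N c b φ (n + 1) x t) :
    SiteRelation N c b φ a n x t := by
  have hB := (h x hx t ht).1
  have hs := schur_ne_zero hB (h' x hx t ht).1
  obtain ⟨hp, hq⟩ := h.relations_ne_zero h' hx ht hne
  rw [SiteRelation, (h x hx t ht).2, (h' x hx t ht).2, recipDiff_coe,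
    add_sub_add_right_eq_sub, quotient_succ hB hs, add_sub_cancel_left, one_div_div,
    div_mul_cancel₀ _ (mul_ne_zero hp hq)]

/-- The relation says that the next site exceeds this one by the increment
`colRelation * rowRelation / schur` of the quotients. -/
lemma succ (h : Represents N c b I J φ a n) (hn : n + 1 < N)
    (hne : ∀ x ∈ I, ∀ t ∈ J, site N c b φ n x t ≠ site N c b φ (n + 1) x t)
    (hpq : ∀ x ∈ I, ∀ t ∈ J, colRelation (a x t) n 0 ≠ 0 ∧ rowRelation (a x t) n 0 ≠ 0)
    (hrel : ∀ x ∈ I, ∀ t ∈ J, SiteRelation N c b φ a n x t) :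
    Represents N c b I J φ a (n + 1) := by
  intro x hx t ht
  obtain ⟨hB, value⟩ := h x hx t ht
  have distinct := hne x hx t ht
  have relation := hrel x hx t ht
  rw [site_succ_of_lt hn, value] at distinct
  rw [SiteRelation, site_succ_of_lt hn, value, recipDiff_coe] at relation
  have increment_ne_zero : φ (n + 1) x t - (quotient (a x t) n + c) ≠ 0 := fun eq =>
    distinct (congrArg _ (sub_eq_zero.1 eq).symm)
  have hs : schur (a x t) n ≠ 0 := by
    rw [← relation]
    exact mul_ne_zero (one_div_ne_zero increment_ne_zero)
      (mul_ne_zero (hpq x hx t ht).1 (hpq x hx t ht).2)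
  have increment : colRelation (a x t) n 0 * rowRelation (a x t) n 0 / schur (a x t) n =
      φ (n + 1) x t - (quotient (a x t) n + c) := by
    rw [div_eq_iff hs, ← relation, ← mul_assoc, mul_one_div_cancel increment_ne_zero, one_mul]
  refine ⟨by rw [det_leadingBlock_succ hB]; exact mul_ne_zero hB hs, ?_⟩
  rw [site_succ_of_lt hn, quotient_succ hB hs, increment]
  congr 1
  ring

lemma dx_eq (h : Represents N c b I J φ a n) (h' : Represents N c b I J φ a (n + 1))
    (ha : IsDerivArray I J a) (hI : IsOpen I) (hn : n + 1 < N) (hx : x ∈ I) (ht : t ∈ J) :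
    dx (φ (n + 1)) x t =
      colRelation (a x t) n 0 * rowRelation (a x t) (n + 1) 0 / schur (a x t) n := by
  refine HasDerivAt.deriv (HasDerivAt.congr_of_eventuallyEq
    ((ha.hasDerivAt_quotient_fst hx ht (h x hx t ht).1 (h' x hx t ht).1).add_const c) ?_)
  filter_upwards [hI.mem_nhds hx] with y hy using ((succ_iff hn).1 h' y hy t ht).2

lemma dt_eq (h : Represents N c b I J φ a n) (h' : Represents N c b I J φ a (n + 1))
    (ha : IsDerivArray I J a) (hJ : IsOpen J) (hn : n + 1 < N) (hx : x ∈ I) (ht : t ∈ J) :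
    dt (φ (n + 1)) x t =
      rowRelation (a x t) n 0 * colRelation (a x t) (n + 1) 0 / schur (a x t) n := by
  refine HasDerivAt.deriv (HasDerivAt.congr_of_eventuallyEq
    ((ha.hasDerivAt_quotient_snd hx ht (h x hx t ht).1 (h' x hx t ht).1).add_const c) ?_)
  filter_upwards [hJ.mem_nhds ht] with s hs using ((succ_iff hn).1 h' x hx s hs).2

lemma dx_dt_eq (h : Represents N c b I J φ a n) (h' : Represents N c b I J φ a (n + 1))
    (ha : IsDerivArray I J a) (hI : IsOpen I) (hJ : IsOpen J) (hn : n + 1 < N) (hx : x ∈ I)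
    (ht : t ∈ J) :
    dx (dt (φ (n + 1))) x t =
      colRelation (a x t) (n + 1) 0 * rowRelation (a x t) (n + 1) 0 / schur (a x t) n -
        colRelation (a x t) n 0 * rowRelation (a x t) n 0 * schur (a x t) (n + 1) /
          schur (a x t) n ^ 2 := by
  refine HasDerivAt.deriv (HasDerivAt.congr_of_eventuallyEq
    (ha.hasDerivAt_quotient_mixed hI hx ht (fun y hy => (h y hy t ht).1) (h' x hx t ht).1) ?_)
  filter_upwards [hI.mem_nhds hx] with y hy using h.dt_eq h' ha hJ hn hy ht

lemma relations_succ_ne_zero (h : Represents N c b I J φ a n)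
    (h' : Represents N c b I J φ a (n + 1)) (ha : IsDerivArray I J a) (hI : IsOpen I)
    (hJ : IsOpen J) (hn : n + 1 < N) (hx : x ∈ I) (ht : t ∈ J) (hdt : dt (φ (n + 1)) x t ≠ 0)
    (hdx : dx (φ (n + 1)) x t ≠ 0) :
    colRelation (a x t) (n + 1) 0 ≠ 0 ∧ rowRelation (a x t) (n + 1) 0 ≠ 0 := by
  rw [h.dt_eq h' ha hJ hn hx ht] at hdt
  rw [h.dx_eq h' ha hI hn hx ht] at hdx
  exact ⟨right_ne_zero_of_mul (div_ne_zero_iff.1 hdt).1,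
    right_ne_zero_of_mul (div_ne_zero_iff.1 hdx).1⟩

lemma equation_iff (h : Represents N c b I J φ a n) (h' : Represents N c b I J φ a (n + 1))
    (ha : IsDerivArray I J a) (hI : IsOpen I) (hJ : IsOpen J) (hn : n + 1 < N) (hx : x ∈ I)
    (ht : t ∈ J) (hne : site N c b φ n x t ≠ site N c b φ (n + 1) x t) :
    dx (dt (φ (n + 1))) x t = dt (φ (n + 1)) x t * dx (φ (n + 1)) x t *
        (recipDiff (site N c b φ (n + 1) x t) (site N c b φ n x t) -
          recipDiff (site N c b φ (n + 2) x t) (site N c b φ (n + 1) x t)) ↔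
      SiteRelation N c b φ a (n + 1) x t := by
  have hs := schur_ne_zero (h x hx t ht).1 (h' x hx t ht).1
  obtain ⟨hp, hq⟩ := h.relations_ne_zero h' hx ht hne
  have recip : recipDiff (site N c b φ (n + 1) x t) (site N c b φ n x t) =
      schur (a x t) n / (colRelation (a x t) n 0 * rowRelation (a x t) n 0) := by
    rw [eq_div_iff (mul_ne_zero hp hq)]
    exact h.siteRelation h' hx ht hne
  rw [h.dx_dt_eq h' ha hI hJ hn hx ht, h.dt_eq h' ha hJ hn hx ht, h.dx_eq h' ha hI hn hx ht, recip,
    SiteRelation, ← sub_eq_zero]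
  refine Iff.trans ?_ sub_eq_zero
  refine Iff.trans (Eq.congr_left ?_) (mul_eq_zero_iff_left
    (div_ne_zero (mul_ne_zero hp hq) (pow_ne_zero 2 hs)))
  field_simp
  ring

variable {m : ℕ}

theorem isSolution (hI : IsOpen I) (hJ : IsOpen J) (ha : IsDerivArray I J a)
    (h : ∀ n < m + 2, Represents (m + 2) c b I J φ a n)
    (smooth : ∀ n, 1 ≤ n → n < m + 2 → ContDiffOn 𝕜 ∞ (fun p : 𝕜 × 𝕜 => φ n p.1 p.2) (I ×ˢ J))
    (distinct : NeighboursDistinct (m + 2) c b I J φ)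
    (last : ∀ x ∈ I, ∀ t ∈ J, SiteRelation (m + 2) c b φ a (m + 1) x t) :
    IsSolution (m + 2) c b I J φ ∧ Nondegenerate (m + 2) I J φ := by
  refine ⟨⟨smooth, distinct, fun n hn hnN x hx t ht => ?_⟩, fun n hn hnN x hx t ht => ?_⟩ <;>
  obtain ⟨n, rfl⟩ := Nat.exists_eq_add_of_le' hn
  · rw [Nat.add_sub_cancel, (h n (by omega)).equation_iff (h (n + 1) hnN) ha hI hJ hnN hx ht
      (distinct n (by omega) x hx t ht)]
    rcases (Nat.lt_succ_iff.1 hnN).eq_or_lt with last_site | inner_site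
    · rw [last_site]
      exact last x hx t ht
    · exact (h (n + 1) hnN).siteRelation (h (n + 2) (by omega)) hx ht
        (distinct (n + 1) hnN x hx t ht)
  · have hs := schur_ne_zero (h n (by omega) x hx t ht).1 (h (n + 1) (by omega) x hx t ht).1
    obtain ⟨hp, hq⟩ := (h n (by omega)).relations_ne_zero (h (n + 1) (by omega)) hx ht
      (distinct n (by omega) x hx t ht)
    obtain ⟨hp', hq'⟩ := (h (n + 1) (by omega)).relations_ne_zero (h (n + 2) hnN) hx ht
      (distinct (n + 1) (by omega) x hx t ht)
    rw [(h n (by omega)).dt_eq (h (n + 1) (by omega)) ha hJ (by omega) hx ht,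
      (h n (by omega)).dx_eq (h (n + 1) (by omega)) ha hI (by omega) hx ht]
    exact ⟨div_ne_zero (mul_ne_zero hq hp') hs, div_ne_zero (mul_ne_zero hp hq') hs⟩

end Represents

namespace IsSolution

variable {m : ℕ}

lemma exists_represents_one (hφ : IsSolution (m + 2) c b I J φ) (hI : IsOpen I) (hJ : IsOpen J) :
    ∃ a, IsDerivArray I J a ∧ Represents (m + 2) c b I J φ a 1 := by
  have sub_ne_zero : ∀ x ∈ I, ∀ t ∈ J, φ 1 x t - c ≠ 0 := fun x hx t ht eq => by
    refine hφ.distinct 0 (by omega) x hx t ht ?_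
    rw [site_zero, site_succ_of_lt (by omega), sub_eq_zero.1 eq]
  refine ⟨_, isDerivArray_iterate (f := fun x t => (φ 1 x t - c)⁻¹) hI hJ
    (((hφ.smooth 1 le_rfl (by omega)).sub contDiffOn_const).inv
      fun p hp => sub_ne_zero _ hp.1 _ hp.2), ?_⟩
  rw [Represents.succ_iff (by omega)]
  intro x hx t ht
  constructor
  · simpa [leadingBlock] using sub_ne_zero x hx t ht
  · simp [quotient, coreMinor, leadingBlock]

theorem exists_represents (hφ : IsSolution (m + 2) c b I J φ)
    (hφ' : Nondegenerate (m + 2) I J φ) (hI : IsOpen I) (hJ : IsOpen J) :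
    ∃ a, IsDerivArray I J a ∧ (∀ n < m + 2, Represents (m + 2) c b I J φ a n) ∧
      ∀ x ∈ I, ∀ t ∈ J, SiteRelation (m + 2) c b φ a (m + 1) x t := by
  obtain ⟨a, ha, h_one⟩ := hφ.exists_represents_one hI hJ
  have relation {n : ℕ} (hn : n + 1 < m + 2) (h : Represents (m + 2) c b I J φ a n)
      (h' : Represents (m + 2) c b I J φ a (n + 1)) :
      ∀ x ∈ I, ∀ t ∈ J, SiteRelation (m + 2) c b φ a (n + 1) x t := fun x hx t ht =>
    (h.equation_iff h' ha hI hJ hn hx ht (hφ.distinct n (by omega) x hx t ht)).1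
      (hφ.equation (n + 1) (by omega) hn x hx t ht)
  have consecutive (n : ℕ) (hn : n + 1 < m + 2) :
      Represents (m + 2) c b I J φ a n ∧ Represents (m + 2) c b I J φ a (n + 1) := by
    induction n with
    | zero => exact ⟨Represents.zero, h_one⟩
    | succ n ih =>
      obtain ⟨h, h'⟩ := ih (by omega)
      refine ⟨h', h'.succ hn (hφ.distinct (n + 1) (by omega)) (fun x hx t ht => ?_)
        (relation (by omega) h h')⟩
      obtain ⟨hdt, hdx⟩ := hφ' (n + 1) (by omega) hn x hx t ht
      exact h.relations_succ_ne_zero h' ha hI hJ (by omega) hx ht hdt hdx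
  refine ⟨a, ha, fun n hn => ?_, ?_⟩
  · cases n with
    | zero => exact Represents.zero
    | succ n => exact (consecutive n hn).2
  · exact relation (by omega) (consecutive m (by omega)).1 (consecutive m (by omega)).2

end IsSolution

end Represents

section LastSite

variable {𝕜 : Type*} [RCLike 𝕜] {n : ℕ} {c d : 𝕜} {I J : Set 𝕜} {φ : ℕ → 𝕜 → 𝕜 → 𝕜}
  {a : 𝕜 → 𝕜 → ℕ → ℕ → 𝕜} {x t : 𝕜}

lemma siteRelation_last_infty_iff (hB : (leadingBlock (a x t) n).det ≠ 0) :
    SiteRelation (n + 1) c OnePoint.infty φ a n x t ↔ (leadingBlock (a x t) (n + 1)).det = 0 := by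
  rw [SiteRelation, site_self, recipDiff_infty, zero_mul, det_leadingBlock_succ hB,
    mul_eq_zero_iff_left hB, eq_comm]

namespace Represents

variable {N : ℕ} {b : OnePoint 𝕜}

lemma sub_quotient_ne_zero (h : Represents N c b I J φ a n) (hx : x ∈ I) (ht : t ∈ J)
    (hne : site N c b φ n x t ≠ d) : d - (quotient (a x t) n + c) ≠ 0 := fun eq =>
  hne ((h x hx t ht).2.trans (congrArg _ (sub_eq_zero.1 eq).symm))

lemma det_addCorner_ne_zero (h : Represents N c b I J φ a (n + 1)) (hcd : c ≠ d) (hx : x ∈ I)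
    (ht : t ∈ J) (hne : site N c b φ (n + 1) x t ≠ d) :
    (leadingBlock (addCorner (c - d)⁻¹ (a x t)) (n + 1)).det ≠ 0 := by
  have hB := (h x hx t ht).1
  have factor : (leadingBlock (addCorner (c - d)⁻¹ (a x t)) (n + 1)).det =
      (leadingBlock (a x t) (n + 1)).det / (d - c) * (d - (quotient (a x t) (n + 1) + c)) := by
    rw [det_leadingBlock_addCorner, quotient]
    have hdc := sub_ne_zero.2 hcd.symm
    field_simp
    ring
  rw [factor]
  exact mul_ne_zero (div_ne_zero hB (sub_ne_zero.2 hcd.symm)) (h.sub_quotient_ne_zero hx ht hne)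

end Represents

lemma siteRelation_last_coe_iff (hcd : c ≠ d)
    (h : Represents (n + 1) c (d : OnePoint 𝕜) I J φ a n) (hx : x ∈ I) (ht : t ∈ J)
    (hne : site (n + 1) c (d : OnePoint 𝕜) φ n x t ≠ d) :
    SiteRelation (n + 1) c (d : OnePoint 𝕜) φ a n x t ↔
      (leadingBlock (addCorner (c - d)⁻¹ (a x t)) (n + 1)).det = 0 := by
  have hcd' := sub_ne_zero.2 hcd
  obtain ⟨hB, value⟩ := h x hx t ht
  rw [SiteRelation, site_self, value, recipDiff_coe, one_div_mul_eq_div,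
    div_eq_iff (h.sub_quotient_ne_zero hx ht hne),
    det_leadingBlock_addCorner, det_leadingBlock_succ hB, coreMinor_eq hB, ← sub_eq_zero,
    ← mul_eq_zero_iff_left (div_ne_zero hB hcd')]
  refine Eq.congr_left ?_
  field_simp
  ring

end LastSite

section InfiniteBoundaryValue

variable {𝕜 : Type*} [RCLike 𝕜] {I J : Set 𝕜} {m : ℕ} {X T : Fin (m + 1) → 𝕜 → 𝕜}

lemma represents_vSol {n : ℕ} (hn : n < m + 2)
    (hB : ∀ n, 1 ≤ n → n < m + 2 → ∀ x ∈ I, ∀ t ∈ J, detB X T n x t ≠ 0) :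
    Represents (m + 2) 0 OnePoint.infty I J (vSol X T) (kernelArray X T) n := by
  cases n with
  | zero => exact Represents.zero
  | succ n =>
    rw [Represents.succ_iff hn]
    exact fun x hx t ht => ⟨hB (n + 1) n.succ_pos hn x hx t ht, (add_zero _).symm⟩

theorem isSolution_vSol (hI : IsOpen I) (hJ : IsOpen J) (hX : ∀ s, ContDiffOn 𝕜 ∞ (X s) I)
    (hT : ∀ s, ContDiffOn 𝕜 ∞ (T s) J)
    (hB : ∀ n, 1 ≤ n → n < m + 2 → ∀ x ∈ I, ∀ t ∈ J, detB X T n x t ≠ 0)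
    (distinct : NeighboursDistinct (m + 2) 0 OnePoint.infty I J (vSol X T)) :
    IsSolution (m + 2) 0 OnePoint.infty I J (vSol X T) ∧ Nondegenerate (m + 2) I J (vSol X T) :=
  Represents.isSolution hI hJ (isDerivArray_kernelArray hI hJ hX hT)
    (fun _ hn => represents_vSol hn hB)
    (fun n hn hnN => (contDiffOn_detA hI hJ hX hT n).div (contDiffOn_detB hI hJ hX hT n)
      fun p hp => hB n hn hnN _ hp.1 _ hp.2)
    distinct
    (fun x hx t ht => (siteRelation_last_infty_iff
      (represents_vSol (by omega) hB x hx t ht).1).2 (detB_succ_eq_zero X T x t))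

lemma detA_ne_zero_of_dt_dx_ne_zero (hI : IsOpen I) (hJ : IsOpen J)
    (hX : ∀ s, ContDiffOn 𝕜 ∞ (X s) I) (hT : ∀ s, ContDiffOn 𝕜 ∞ (T s) J)
    (hB : ∀ n, 1 ≤ n → n < m + 2 → ∀ x ∈ I, ∀ t ∈ J, detB X T n x t ≠ 0) {x t : 𝕜} (hx : x ∈ I)
    (ht : t ∈ J) (hdt : dt (vSol X T (m + 1)) x t ≠ 0) (hdx : dx (vSol X T (m + 1)) x t ≠ 0) :
    detA X T (m + 2) x t ≠ 0 := by
  have h := represents_vSol (by omega : m < m + 2) hB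
  have h' := represents_vSol (by omega : m + 1 < m + 2) hB
  obtain ⟨hp, hq⟩ := h.relations_succ_ne_zero h' (isDerivArray_kernelArray hI hJ hX hT) hI hJ
    (by omega) hx ht hdt hdx
  have hB' := (h' x hx t ht).1
  have hs : schur (kernelArray X T x t) (m + 1) = 0 := by
    rw [← mul_eq_zero_iff_left hB', ← det_leadingBlock_succ hB']
    exact detB_succ_eq_zero X T x t
  rw [detA_succ_eq, coreMinor_eq hB', hs, zero_mul, zero_add]
  exact mul_ne_zero hB' (mul_ne_zero hp hq)

theorem exists_vSol_of_isSolution (hI : IsOpen I) (hI' : IsPreconnected I) (hJ : IsOpen J)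
    (hJ' : IsPreconnected J) {v : ℕ → 𝕜 → 𝕜 → 𝕜} (hv : IsSolution (m + 2) 0 OnePoint.infty I J v)
    (hv' : Nondegenerate (m + 2) I J v) :
    ∃ X T : Fin (m + 1) → 𝕜 → 𝕜,
      (∀ s, ContDiffOn 𝕜 ∞ (X s) I) ∧ (∀ s, ContDiffOn 𝕜 ∞ (T s) J) ∧
      ∀ n, 1 ≤ n → n < m + 2 → ∀ x ∈ I, ∀ t ∈ J,
        detB X T n x t ≠ 0 ∧ v n x t = detA X T n x t / detB X T n x t := by
  obtain ⟨e, he, represents, last⟩ := hv.exists_represents hv' hI hJ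
  have hB := fun x hx t ht => (represents (m + 1) (by omega) x hx t ht).1
  obtain ⟨X, T, hX, hT, kernel⟩ := he.exists_eq_kernelArray hI hI' hJ hJ' hB fun x hx t ht =>
    (siteRelation_last_infty_iff (hB x hx t ht)).1 (last x hx t ht)
  refine ⟨X, T, hX, hT, fun n hn hnN x hx t ht => ?_⟩
  obtain ⟨n, rfl⟩ := Nat.exists_eq_add_of_le' hn
  obtain ⟨hBn, value⟩ := (Represents.succ_iff hnN).1 (represents (n + 1) hnN) x hx t ht
  rw [kernel x hx t ht] at hBn value
  exact ⟨hBn, value.trans (add_zero _)⟩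

end InfiniteBoundaryValue

section FiniteBoundaryValue

variable {𝕜 : Type*} [RCLike 𝕜] {a b : 𝕜}

lemma phiDen_succ {m : ℕ} (hab : a ≠ b) (X T : Fin m → 𝕜 → 𝕜) (n : ℕ) (x t : 𝕜) :
    phiDen a b X T (n + 1) x t = (a - b) *
      (leadingBlock (addCorner (-(a - b)⁻¹) (kernelArray X T x t)) (n + 1)).det := by
  rw [phiDen, detB_eq, detA_succ_eq, det_leadingBlock_addCorner, mul_add, neg_mul, mul_neg,
    mul_inv_cancel_left₀ (sub_ne_zero.2 hab), sub_eq_add_neg]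

lemma phiSol_succ {m : ℕ} (hab : a ≠ b) (X T : Fin m → 𝕜 → 𝕜) (n : ℕ) (x t : 𝕜) :
    phiSol a b X T (n + 1) x t =
      quotient (addCorner (-(a - b)⁻¹) (kernelArray X T x t)) (n + 1) + a := by
  rw [phiSol, phiDen_succ hab, detA_succ_eq, mul_div_mul_left _ _ (sub_ne_zero.2 hab), quotient,
    coreMinor_addCorner]

lemma phiSol_eq_mobius {m : ℕ} (a b : 𝕜) {X T : Fin m → 𝕜 → 𝕜} {n : ℕ} {x t : 𝕜}
    (h : detB X T n x t ≠ 0) : phiSol a b X T n x t = mobius a b (vSol X T n x t) := by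
  have den : phiDen a b X T n x t = (a - b - vSol X T n x t) * detB X T n x t := by
    rw [phiDen, vSol, sub_mul (a - b), div_mul_cancel₀ _ h]
  rw [phiSol, mobius, den, vSol, ← mul_div_assoc, div_div, mul_comm (detB X T n x t)]

variable {I J : Set 𝕜} {m : ℕ} {X T : Fin (m + 1) → 𝕜 → 𝕜}

lemma represents_phiSol {n : ℕ} (hn : n < m + 2) (hab : a ≠ b)
    (hD : ∀ n, 1 ≤ n → n < m + 2 → ∀ x ∈ I, ∀ t ∈ J, phiDen a b X T n x t ≠ 0) :
    Represents (m + 2) a (b : OnePoint 𝕜) I J (phiSol a b X T)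
      (fun x t => addCorner (-(a - b)⁻¹) (kernelArray X T x t)) n := by
  cases n with
  | zero => exact Represents.zero
  | succ n =>
    rw [Represents.succ_iff hn]
    refine fun x hx t ht => ⟨?_, phiSol_succ hab X T n x t⟩
    exact right_ne_zero_of_mul (phiDen_succ hab X T n x t ▸ hD (n + 1) n.succ_pos hn x hx t ht)

theorem isSolution_phiSol (hI : IsOpen I) (hJ : IsOpen J) (hab : a ≠ b)
    (hX : ∀ s, ContDiffOn 𝕜 ∞ (X s) I) (hT : ∀ s, ContDiffOn 𝕜 ∞ (T s) J)
    (hD : ∀ n, 1 ≤ n → n < m + 2 → ∀ x ∈ I, ∀ t ∈ J, phiDen a b X T n x t ≠ 0)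
    (distinct : NeighboursDistinct (m + 2) a (b : OnePoint 𝕜) I J (phiSol a b X T)) :
    IsSolution (m + 2) a (b : OnePoint 𝕜) I J (phiSol a b X T) ∧
      Nondegenerate (m + 2) I J (phiSol a b X T) := by
  refine Represents.isSolution hI hJ ((isDerivArray_kernelArray hI hJ hX hT).addCorner _)
    (fun _ hn => represents_phiSol hn hab hD) (fun n hn hnN => ?_) distinct
    (fun x hx t ht => ?_)
  · have hA := contDiffOn_detA hI hJ hX hT n
    exact ((contDiffOn_const.mul hA).div
      ((contDiffOn_const.mul (contDiffOn_detB hI hJ hX hT n)).sub hA)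
      fun p hp => hD n hn hnN _ hp.1 _ hp.2).add contDiffOn_const
  · have last_ne := distinct (m + 1) (by omega) x hx t ht
    rw [site_self] at last_ne
    rw [siteRelation_last_coe_iff hab (represents_phiSol (by omega) hab hD) hx ht last_ne,
      addCorner_addCorner, neg_add_cancel, addCorner_zero]
    exact detB_succ_eq_zero X T x t

theorem exists_phiSol_of_isSolution (hI : IsOpen I) (hI' : IsPreconnected I) (hJ : IsOpen J)
    (hJ' : IsPreconnected J) (hab : a ≠ b) {φ : ℕ → 𝕜 → 𝕜 → 𝕜}
    (hφ : IsSolution (m + 2) a (b : OnePoint 𝕜) I J φ) (hφ' : Nondegenerate (m + 2) I J φ) :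
    ∃ X T : Fin (m + 1) → 𝕜 → 𝕜,
      (∀ s, ContDiffOn 𝕜 ∞ (X s) I) ∧ (∀ s, ContDiffOn 𝕜 ∞ (T s) J) ∧
      ∀ n, 1 ≤ n → n < m + 2 → ∀ x ∈ I, ∀ t ∈ J,
        phiDen a b X T n x t ≠ 0 ∧ φ n x t = phiSol a b X T n x t := by
  obtain ⟨e, he, represents, last⟩ := hφ.exists_represents hφ' hI hJ
  have last_ne (x) (hx : x ∈ I) (t) (ht : t ∈ J) :
      site (m + 2) a (b : OnePoint 𝕜) φ (m + 1) x t ≠ b := by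
    simpa only [site_self] using hφ.distinct (m + 1) (by omega) x hx t ht
  obtain ⟨X, T, hX, hT, kernel⟩ := (he.addCorner (a - b)⁻¹).exists_eq_kernelArray hI hI' hJ hJ'
    (fun x hx t ht => (represents _ (by omega)).det_addCorner_ne_zero hab hx ht (last_ne x hx t ht))
    (fun x hx t ht => (siteRelation_last_coe_iff hab (represents _ (by omega)) hx ht
      (last_ne x hx t ht)).1 (last x hx t ht))
  refine ⟨X, T, hX, hT, fun n hn hnN x hx t ht => ?_⟩
  obtain ⟨n, rfl⟩ := Nat.exists_eq_add_of_le' hn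
  obtain ⟨hBn, value⟩ := (Represents.succ_iff hnN).1 (represents (n + 1) hnN) x hx t ht
  rw [phiDen_succ hab, phiSol_succ hab, ← kernel x hx t ht, addCorner_addCorner, add_neg_cancel,
    addCorner_zero]
  exact ⟨mul_ne_zero (sub_ne_zero.2 hab) hBn, value⟩

end FiniteBoundaryValue

end FSY

theorem mainTheorem5 {𝕜 : Type*} [RCLike 𝕜] (N : ℕ) (hN : 2 ≤ N) (I J : Set 𝕜)
    (hI : IsOpen I) (hI' : IsPreconnected I) (hJ : IsOpen J) (hJ' : IsPreconnected J) :
    -- boundary condition `v_0 = 0`, `v_N = ∞`: the formula gives solutions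
    (∀ X T : Fin (N - 1) → 𝕜 → 𝕜,
      (∀ s, ContDiffOn 𝕜 ∞ (X s) I) → (∀ s, ContDiffOn 𝕜 ∞ (T s) J) →
      (∀ n, 1 ≤ n → n < N → ∀ x ∈ I, ∀ t ∈ J, FSY.detB X T n x t ≠ 0) →
      FSY.NeighboursDistinct N 0 OnePoint.infty I J (FSY.vSol X T) →
        FSY.IsSolution N 0 OnePoint.infty I J (FSY.vSol X T) ∧
        FSY.Nondegenerate N I J (FSY.vSol X T) ∧
        -- the formula with `n = N` has denominator zero, and is a genuine `∞` (nonzero numerator)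
        -- wherever the derivatives of `v_{N-1}` do not vanish
        ∀ x ∈ I, ∀ t ∈ J, FSY.detB X T N x t = 0 ∧
          (FSY.dt (FSY.vSol X T (N - 1)) x t ≠ 0 → FSY.dx (FSY.vSol X T (N - 1)) x t ≠ 0 →
            FSY.detA X T N x t ≠ 0)) ∧
    -- boundary condition `v_0 = 0`, `v_N = ∞`: every nondegenerate solution is given by the formula
    (∀ v : ℕ → 𝕜 → 𝕜 → 𝕜,
      FSY.IsSolution N 0 OnePoint.infty I J v → FSY.Nondegenerate N I J v →
        ∃ X T : Fin (N - 1) → 𝕜 → 𝕜,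
          (∀ s, ContDiffOn 𝕜 ∞ (X s) I) ∧ (∀ s, ContDiffOn 𝕜 ∞ (T s) J) ∧
          ∀ n, 1 ≤ n → n < N → ∀ x ∈ I, ∀ t ∈ J,
            FSY.detB X T n x t ≠ 0 ∧ v n x t = FSY.detA X T n x t / FSY.detB X T n x t) ∧
    -- boundary condition `φ_0 = a`, `φ_N = b`
    (∀ a b : 𝕜, a ≠ b →
      (∀ X T : Fin (N - 1) → 𝕜 → 𝕜,
        (∀ s, ContDiffOn 𝕜 ∞ (X s) I) → (∀ s, ContDiffOn 𝕜 ∞ (T s) J) →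
        (∀ n, 1 ≤ n → n < N → ∀ x ∈ I, ∀ t ∈ J, FSY.phiDen a b X T n x t ≠ 0) →
        FSY.NeighboursDistinct N a (b : OnePoint 𝕜) I J (FSY.phiSol a b X T) →
          FSY.IsSolution N a (b : OnePoint 𝕜) I J (FSY.phiSol a b X T) ∧
          FSY.Nondegenerate N I J (FSY.phiSol a b X T)) ∧
      (∀ φ : ℕ → 𝕜 → 𝕜 → 𝕜,
        FSY.IsSolution N a (b : OnePoint 𝕜) I J φ → FSY.Nondegenerate N I J φ →
          ∃ X T : Fin (N - 1) → 𝕜 → 𝕜,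
            (∀ s, ContDiffOn 𝕜 ∞ (X s) I) ∧ (∀ s, ContDiffOn 𝕜 ∞ (T s) J) ∧
            ∀ n, 1 ≤ n → n < N → ∀ x ∈ I, ∀ t ∈ J,
              FSY.phiDen a b X T n x t ≠ 0 ∧ φ n x t = FSY.phiSol a b X T n x t) ∧
      -- `phiSol` is the Möbius image of `vSol`
      (∀ (X T : Fin (N - 1) → 𝕜 → 𝕜) (n : ℕ) (x t : 𝕜), FSY.detB X T n x t ≠ 0 →
        FSY.phiSol a b X T n x t = FSY.mobius a b (FSY.vSol X T n x t))) := by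
  obtain ⟨m, rfl⟩ : ∃ m, N = m + 2 := ⟨N - 2, by omega⟩
  refine ⟨fun X T hX hT hB distinct => ?_,
    fun v hv hv' => FSY.exists_vSol_of_isSolution hI hI' hJ hJ' hv hv',
    fun a b hab => ⟨fun X T hX hT hD distinct => FSY.isSolution_phiSol hI hJ hab hX hT hD distinct,
      fun φ hφ hφ' => FSY.exists_phiSol_of_isSolution hI hI' hJ hJ' hab hφ hφ',
      fun X T n x t h => FSY.phiSol_eq_mobius a b h⟩⟩
  obtain ⟨solution, nondegenerate⟩ := FSY.isSolution_vSol hI hJ hX hT hB distinct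
  exact ⟨solution, nondegenerate, fun x hx t ht => ⟨FSY.detB_succ_eq_zero X T x t,
    fun hdt hdx => FSY.detA_ne_zero_of_dt_dx_ne_zero hI hJ hX hT hB hx ht hdt hdx⟩⟩
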